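/- **Definitions.** A *contextuality scenario* $H$ is a finite vertex set $V(H)$ with a set $E(H)$ of subsets of $V(H)$ (edges) covering $V(H)$. Its *non-orthogonality graph* $\mathrm{NO}(H)$ is the graph on $V(H)$ in which $u\sim v$ iff no edge contains both $u$ and $v$. $\mathcal G(H)$ is the set of *probabilistic models* $p:V(H)\to[0,1]$ with $\sum_{v\in e}p(v)=1$ for all $e\in E(H)$. $\mathcal Q(H)$ is the set of *quantum models* $p(v)=\mathrm{tr}(\rho P_v)$, where $\rho$ is a density operator on some complex Hilbert space and the $P_v$ are projections with $\sum_{v\in e}P_v=\mathbb 1$ for all $e\in E(H)$. $\mathcal{CE}^1(H)$ is the set of $p\in\mathcal G(H)$ with $\sum_{v\in I}p(v)\le 1$ for every independent set $I$ of $\mathrm{NO}(H)$. The *Foulis–Randall product* $H_A\otimes H_B$ has vertex set $V(H_A)\times V(H_B)$ and as edges all sets $\bigcup_{a\in e_A}\{a\}\times f(a)$ with $e_A\in E(H_A)$, $f:e_A\to E(H_B)$, and all sets $\bigcup_{b\in e_B}f(b)\times\{b\}$ with $e_B\in E(H_B)$, $f:e_B\to E(H_A)$; and $(p_A\otimes p_B)(a,b)=p_A(a)p_B(b)$.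 $H^{\otimes n}$ and $p^{\otimes n}$ are the iterated products, $\mathcal{CE}^n(H)=\{p\in\mathcal G(H): p^{\otimes n}\in\mathcal{CE}^1(H^{\otimes n})\}$ and $\mathcal{CE}^\infty(H)=\bigcap_n\mathcal{CE}^n(H)$. An *orthonormal labeling* of a graph $G$ assigns to every vertex $v$ a unit vector $\psi_v\in\mathbb R^{V(G)}$ such that $\psi_u\perp\psi_v$ whenever $u\ne v$ and $u\not\sim v$. The Lovász number is $\vartheta(G)=\min_{\Psi,\psi}\max_v |\langle\Psi,\psi_v\rangle|^{-2}$ over unit vectors $\Psi\in\mathbb R^{V(G)}$ and orthonormal labelings $\psi$ of $G$. **Theorem.** There are contextuality scenarios $H_A,H_B$ and models $p_A\in\mathcal{CE}^\infty(H_A)$, $p_B\in\mathcal Q(H_B)\subseteq\mathcal{CE}^\infty(H_B)$ with $p_A\otimes p_B\in\mathcal G(H_A\otimes H_B)$ but $p_A\otimes p_B\notin\mathcal{CE}^1(H_A\otimes H_B)$. In particular $\mathcal{CE}^\infty(H_A)\otimes\mathcal{CE}^\infty(H_B)\not\subseteq\mathcal{CE}^1(H_A\otimes H_B)$: violations of Consistent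 Exclusivity can be activated. Explicitly, one may take the following. * $H_A=J_{12}$: the vertices are the $220$ three-element subsets of $\{1,\dots,12\}$; each partition of $\{1,\dots,12\}$ into four-element subsets gives an edge, consisting of the triples contained in one of its parts. In $\mathrm{NO}(J_{12})$, $v\sim w$ iff $|v\cap w|=1$. The model is $p_A(v)=\tfrac1{12}$ for all $v$. * $H_B$: the vertices are the vertices of $J_{12}$ together with one vertex $w_e$ for each edge $e$ of the graph $\mathrm{NO}(J_{12})$; the edges are the sets $\{u,v,w_e\}$ for $e=\{u,v\}$ an edge of $\mathrm{NO}(J_{12})$. The model is $p_B(v)=\tfrac{13}{121}$ on triples and $p_B(w_e)=\tfrac{95}{121}$. Moreover let $D_i(v)=\{w: |v\cap w|=3-i\}$ for $0\le i\le 3$, and in $\mathbb R^{220}$ with canonical basis $(|w\rangle)_w$ put $$\phi_v=\sum_{i=0}^3\frac{\alpha_i}{\sqrt{|D_i(v)|}}\sum_{w\in D_i(v)}|w\rangle,\qquad \Psi=\frac1{\sqrt{220}}\sum_w|w\rangle,\qquad \alpha=\frac{\sqrt{13}}{11}\,b+\frac{6\sqrt3}{11}\,c,$$ $$b=\frac1{2\sqrt{55}}\left(1,\,3\sqrt3,\,6\sqrt3,\,2\sqrt{21}\right),\qquad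 c=\frac1{2\sqrt{110}}\left(6\sqrt3,\,10,\,-13,\,3\sqrt7\right).$$ Then $(\phi_v)_v$ is an orthonormal labeling of the complement $\overline{\mathrm{NO}(J_{12})}$, $\Psi$ is a unit vector, $|\langle\Psi,\phi_v\rangle|^2=\tfrac{13}{121}$ for every $v$, and $$\sum_v|\langle\Psi,\phi_v\rangle|^2=\frac{260}{11}=\vartheta(\mathrm{NO}(J_{12})).$$ This is the maximal value of $\sum_v|\langle\Psi',\phi'_v\rangle|^2$ over all unit vectors $\Psi'\in\mathbb R^{220}$ and all orthonormal labelings $\phi'$ of $\overline{\mathrm{NO}(J_{12})}$. -/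

import Mathlib

open scoped InnerProductSpace ENNReal

/-- A contextuality scenario on the vertex set `V`: a finite hypergraph whose edges cover all the
vertices. Vertices are measurement outcomes, edges are measurements. -/
structure ContextualityScenario (V : Type) where
  finite : Finite V
  edges : Set (Finset V)
  cover : ∀ v : V, ∃ e ∈ edges, v ∈ e

namespace ContextualityScenario

/-- The non-orthogonality graph `NO(H)`: `u` and `v` are adjacent iff no edge contains both. -/
def nonOrthGraph {V : Type} (H : ContextualityScenario V) : SimpleGraph V where
  Adj u v := ¬ ∃ e ∈ H.edges, u ∈ e ∧ v ∈ e
  symm := ⟨fun _ _ h ⟨e, he, hv, hu⟩ => h ⟨e, he, hu, hv⟩⟩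
  loopless := ⟨fun v h => by
    obtain ⟨e, he, hv⟩ := H.cover v
    exact h ⟨e, he, hv, hv⟩⟩

/-- `𝒢(H)`: the probabilistic models `p : V(H) → [0,1]`, normalized on every edge. -/
def probModels {V : Type} (H : ContextualityScenario V) : Set (V → ℝ) :=
  {p | (∀ v, 0 ≤ p v ∧ p v ≤ 1) ∧ ∀ e ∈ H.edges, ∑ v ∈ e, p v = 1}

/-- The Foulis-Randall product `H_A ⊗ H_B`. The edges are the sets `⋃_{a ∈ e_A} {a} × f(a)` with
`e_A ∈ E(H_A)` and `f : e_A → E(H_B)`, and the sets `⋃_{b ∈ e_B} f(b) × {b}` with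
`e_B ∈ E(H_B)` and `f : e_B → E(H_A)`. -/
def prod {V W : Type} (HA : ContextualityScenario V) (HB : ContextualityScenario W) :
    ContextualityScenario (V × W) where
  finite := by
    have := HA.finite
    have := HB.finite
    infer_instance
  edges :=
    {e | ∃ eA ∈ HA.edges, ∃ f : V → Finset W, (∀ a ∈ eA, f a ∈ HB.edges) ∧
        ∀ x : V × W, x ∈ e ↔ x.1 ∈ eA ∧ x.2 ∈ f x.1} ∪
    {e | ∃ eB ∈ HB.edges, ∃ f : W → Finset V, (∀ b ∈ eB, f b ∈ HA.edges) ∧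
        ∀ x : V × W, x ∈ e ↔ x.2 ∈ eB ∧ x.1 ∈ f x.2}
  cover := by
    rintro ⟨a, b⟩
    obtain ⟨eA, hA, ha⟩ := HA.cover a
    obtain ⟨eB, hB, hb⟩ := HB.cover b
    exact ⟨eA ×ˢ eB, Or.inl ⟨eA, hA, fun _ => eB, fun _ _ => hB, fun x => Finset.mem_product⟩,
      Finset.mem_product.2 ⟨ha, hb⟩⟩

/-- The product `p_A ⊗ p_B` of two probability assignments. -/
def tensor {V W : Type} (pA : V → ℝ) (pB : W → ℝ) : V × W → ℝ := fun x => pA x.1 * pB x.2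

/-- The vertices of `H^{⊗ n}`: `n`-tuples of vertices, left-bracketed. -/
def PowVertex (V : Type) : ℕ → Type
  | 0 => Unit
  | 1 => V
  | n + 2 => PowVertex V (n + 1) × V

/-- The `n`-fold product `H^{⊗ n}`, as an iterated Foulis-Randall product; `H^{⊗ 0}` is the
scenario with one vertex and one edge. -/
def pow {V : Type} (H : ContextualityScenario V) : (n : ℕ) → ContextualityScenario (PowVertex V n)
  | 0 =>
    { finite := inferInstanceAs (Finite Unit)
      edges := {e | ∀ x : Unit, x ∈ e}
      cover := fun x => ⟨({x} : Finset Unit), fun y => Finset.mem_singleton.2 (Subsingleton.elim y x),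
        Finset.mem_singleton_self x⟩ }
  | 1 => H
  | n + 2 => (H.pow (n + 1)).prod H

/-- The `n`-fold tensor power `p^{⊗ n}` of a probability assignment. -/
def tensorPow {V : Type} (p : V → ℝ) : (n : ℕ) → PowVertex V n → ℝ
  | 0 => fun _ => 1
  | 1 => p
  | n + 2 => tensor (tensorPow p (n + 1)) p

/-- `𝒞ℰ¹(H)`: the probabilistic models satisfying Consistent Exclusivity. -/
def consistentExclusivity {V : Type} (H : ContextualityScenario V) : Set (V → ℝ) :=
  {p | p ∈ H.probModels ∧
    ∀ I : Finset V, H.nonOrthGraph.IsIndepSet (I : Set V) → ∑ v ∈ I, p v ≤ 1}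

/-- `𝒞ℰⁿ(H)`: the probabilistic models `p` with `p^{⊗ n} ∈ 𝒞ℰ¹(H^{⊗ n})`. -/
def consistentExclusivityPow {V : Type} (H : ContextualityScenario V) (n : ℕ) : Set (V → ℝ) :=
  {p | p ∈ H.probModels ∧ tensorPow p n ∈ (H.pow n).consistentExclusivity}

/-- `𝒞ℰ^∞(H) = ⋂ₙ 𝒞ℰⁿ(H)`. -/
def consistentExclusivityInf {V : Type} (H : ContextualityScenario V) : Set (V → ℝ) :=
  ⋂ n : ℕ, H.consistentExclusivityPow n

end ContextualityScenario

/-- `T` has trace `t`: in every orthonormal (Hilbert) basis, the diagonal entries of `T` sum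
unconditionally to `t`. On trace class operators this is the usual trace, and a positive operator
has a trace in this sense iff it is trace class. -/
def HasOperatorTrace {K : Type} [NormedAddCommGroup K] [InnerProductSpace ℂ K]
    (T : K →L[ℂ] K) (t : ℂ) : Prop :=
  ∀ (ι : Type) (b : HilbertBasis ι ℂ K), HasSum (fun i => ⟪b i, T (b i)⟫_ℂ) t

/-- `𝒬(H)`: the quantum models. There are a complex Hilbert space `K` of any dimension, a density
operator `ρ` and projections `P v` that sum to the identity on every edge, with
`p v = tr (ρ (P v))`. -/
def ContextualityScenario.quantumModels {V : Type} (H : ContextualityScenario V) : Set (V → ℝ) :=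
  {p | ∃ (K : Type) (_ : NormedAddCommGroup K) (_ : InnerProductSpace ℂ K) (_ : CompleteSpace K)
    (ρ : K →L[ℂ] K) (P : V → K →L[ℂ] K),
    ρ.IsPositive ∧ HasOperatorTrace ρ 1 ∧
    (∀ v, IsStarProjection (P v)) ∧
    (∀ e ∈ H.edges, ∑ v ∈ e, P v = 1) ∧
    ∀ v, HasOperatorTrace (ρ * P v) ((p v : ℝ) : ℂ)}

/-- An orthonormal labeling of a graph `G` on `V`: unit vectors in `ℝ^V`, orthogonal at distinct
non-adjacent vertices. -/
def IsOrthonormalLabeling {V : Type} [Fintype V] (G : SimpleGraph V)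
    (ψ : V → EuclideanSpace ℝ V) : Prop :=
  (∀ v, ‖ψ v‖ = 1) ∧ ∀ u v, u ≠ v → ¬ G.Adj u v → ⟪ψ u, ψ v⟫_ℝ = 0

/-- The Lovász number `ϑ(G) = min_{Ψ, ψ} max_v 1 / |⟨Ψ, ψ_v⟩|²`, over unit vectors `Ψ` and
orthonormal labelings `ψ` of `G`; the quotient is `∞` where `⟨Ψ, ψ_v⟩ = 0`. -/
noncomputable def lovaszNumber {V : Type} [Fintype V] (G : SimpleGraph V) : ℝ≥0∞ :=
  ⨅ (Ψ : EuclideanSpace ℝ V) (ψ : V → EuclideanSpace ℝ V) (_ : ‖Ψ‖ = 1)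
    (_ : IsOrthonormalLabeling G ψ), ⨆ v, (ENNReal.ofReal (⟪Ψ, ψ v⟫_ℝ ^ 2))⁻¹

/-- For a graph `G` without isolated vertices, the scenario with vertices `V(G) ∪ E(G)` and with
an edge `{u, v, w_e}` for every `e = {u, v} ∈ E(G)`, where `w_e` is the vertex belonging to `e`
(a no-detection event). -/
def noDetectionScenario {V : Type} [Finite V] (G : SimpleGraph V)
    (hG : ∀ v, ∃ w, G.Adj v w) : ContextualityScenario (V ⊕ G.edgeSet) where
  finite := inferInstance
  edges := {f | ∃ e : G.edgeSet, ∀ x : V ⊕ G.edgeSet,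
    x ∈ f ↔ x = Sum.inr e ∨ ∃ u ∈ (e : Sym2 V), x = Sum.inl u}
  cover := by
    classical
    have key : ∀ v w (h : G.Adj v w),
        ∀ x : V ⊕ G.edgeSet, x ∈ ({Sum.inl v, Sum.inl w, Sum.inr ⟨s(v, w), h⟩} :
          Finset (V ⊕ G.edgeSet)) ↔
          x = Sum.inr ⟨s(v, w), h⟩ ∨ ∃ u ∈ s(v, w), x = Sum.inl u := by
      intro v w h x
      simp only [Finset.mem_insert, Finset.mem_singleton, Sym2.mem_iff]
      constructor
      · rintro (hx | hx | hx)
        · exact Or.inr ⟨v, Or.inl rfl, hx⟩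
        · exact Or.inr ⟨w, Or.inr rfl, hx⟩
        · exact Or.inl hx
      · rintro (hx | ⟨u, rfl | rfl, hx⟩)
        · exact Or.inr (Or.inr hx)
        · exact Or.inl hx
        · exact Or.inr (Or.inl hx)
    rintro (v | ⟨e, he⟩)
    · obtain ⟨w, h⟩ := hG v
      exact ⟨_, ⟨⟨s(v, w), h⟩, key v w h⟩, by simp⟩
    · induction e using Sym2.ind with
      | _ v w => exact ⟨_, ⟨⟨s(v, w), he⟩, key v w he⟩, by simp⟩

/-- The `3`-element subsets of a `12`-element set. -/
abbrev Triple : Type := {s : Finset (Fin 12) // s.card = 3}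

theorem exists_quad_partition (v : Triple) :
    ∃ P : Finpartition (Finset.univ : Finset (Fin 12)),
      (∀ t ∈ P.parts, t.card = 4) ∧ ∃ t ∈ P.parts, v.1 ⊆ t := by
  obtain ⟨v, hv⟩ := v
  obtain ⟨s, hvs, -, hs⟩ := Finset.exists_subsuperset_card_eq (Finset.subset_univ v)
    (show v.card ≤ 4 by omega) (show 4 ≤ (Finset.univ : Finset (Fin 12)).card by simp)
  have hsc : sᶜ.card = 8 := by rw [Finset.card_compl, hs]; rfl
  obtain ⟨t, hts, ht⟩ := Finset.exists_subset_card_eq (show 4 ≤ sᶜ.card by omega)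
  have hr : (sᶜ \ t).card = 4 := by rw [Finset.card_sdiff_of_subset hts]; omega
  have hds : Disjoint s t := (disjoint_compl_right (a := s)).mono_right hts
  have hdr : Disjoint s (sᶜ \ t) := (disjoint_compl_right (a := s)).mono_right Finset.sdiff_subset
  have htr : Disjoint t (sᶜ \ t) := disjoint_sdiff_self_right
  refine ⟨{ parts := {s, t, sᶜ \ t}, supIndep := ?_, sup_parts := ?_, bot_notMem := ?_ }, ?_, ?_⟩
  · rw [Finset.supIndep_iff_pairwiseDisjoint]
    intro a ha b hb hab
    simp only [Finset.coe_insert, Finset.coe_singleton, Set.mem_insert_iff,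
      Set.mem_singleton_iff] at ha hb
    rcases ha with rfl | rfl | rfl <;> rcases hb with rfl | rfl | rfl <;>
      first
      | exact absurd rfl hab
      | assumption
      | exact Disjoint.symm (by assumption)
  · simp only [Finset.sup_insert, Finset.sup_singleton, id, Finset.sup_eq_union]
    rw [Finset.union_sdiff_of_subset hts, Finset.union_compl]
  · intro h
    simp only [Finset.mem_insert, Finset.mem_singleton, Finset.bot_eq_empty] at h
    rcases h with h | h | h
    · rw [← h] at hs; simp at hs
    · rw [← h] at ht; simp at ht
    · rw [← h] at hr; simp at hr
  · intro a ha
    simp only [Finset.mem_insert, Finset.mem_singleton] at ha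
    rcases ha with rfl | rfl | rfl <;> assumption
  · exact ⟨s, by simp, hvs⟩

/-- The scenario `J₁₂`: the vertices are the `3`-element subsets of a `12`-element set; for every
partition into `4`-element subsets, the triples contained in one of its parts form an edge. -/
def scenarioJ12 : ContextualityScenario Triple where
  finite := inferInstance
  edges := {e | ∃ P : Finpartition (Finset.univ : Finset (Fin 12)),
    (∀ t ∈ P.parts, t.card = 4) ∧ ∀ v : Triple, v ∈ e ↔ ∃ t ∈ P.parts, v.1 ⊆ t}
  cover := fun v => by
    obtain ⟨P, hP, hv⟩ := exists_quad_partition v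
    exact ⟨Finset.univ.filter fun w : Triple => ∃ t ∈ P.parts, w.1 ⊆ t, ⟨P, hP, by simp⟩,
      by simpa using hv⟩

theorem scenarioJ12_no_isolated (v : Triple) : ∃ w, scenarioJ12.nonOrthGraph.Adj v w := by
  obtain ⟨v, hv⟩ := v
  obtain ⟨x, hx⟩ := Finset.card_pos.1 (show 0 < v.card by omega)
  have hvc : vᶜ.card = 9 := by rw [Finset.card_compl, hv]; rfl
  obtain ⟨t, htv, ht⟩ := Finset.exists_subset_card_eq (show 2 ≤ vᶜ.card by omega)
  have hxt : x ∉ t := fun h => Finset.mem_compl.1 (htv h) hx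
  refine ⟨⟨insert x t, by rw [Finset.card_insert_of_notMem hxt, ht]⟩, ?_⟩
  rintro ⟨e, ⟨P, hP, he⟩, hve, hwe⟩
  obtain ⟨a, ha, hva⟩ := (he _).1 hve
  obtain ⟨b, hb, hwb⟩ := (he _).1 hwe
  have hab : a = b := P.eq_of_mem_parts ha hb (hva hx) (hwb (Finset.mem_insert_self x t))
  subst hab
  have hsub : v ∪ t ⊆ a := Finset.union_subset hva ((Finset.subset_insert x t).trans hwb)
  have hd : Disjoint v t := (disjoint_compl_right (a := v)).mono_right htv
  have := Finset.card_le_card hsub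
  rw [Finset.card_union_of_disjoint hd, hP a ha, hv, ht] at this
  omega

/-- The second scenario `H_B`, with vertices `V(J₁₂) ∪ E(NO(J₁₂))` and edges `{u, v, w_{uv}}`. -/
def activatingScenario :
    ContextualityScenario (Triple ⊕ scenarioJ12.nonOrthGraph.edgeSet) :=
  noDetectionScenario scenarioJ12.nonOrthGraph scenarioJ12_no_isolated

/-- The model `p_A` on `J₁₂`: the uniform weight `1/12`. -/
noncomputable def modelA : Triple → ℝ := fun _ => 1 / 12

/-- The model `p_B` on `H_B`: weight `13/121` on triples and `95/121` on the vertices `w_{uv}`. -/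
noncomputable def modelB : Triple ⊕ scenarioJ12.nonOrthGraph.edgeSet → ℝ :=
  Sum.elim (fun _ => 13 / 121) (fun _ => 95 / 121)

/-- `D_i(v)`: the triples that differ from `v` in exactly `i` elements. -/
def tripleSphere (i : Fin 4) (v : Triple) : Finset Triple :=
  Finset.univ.filter fun w => (v.1 ∩ w.1).card + (i : ℕ) = 3

/-- The unit vector `b = (√|D₀|, √|D₁|, √|D₂|, √|D₃|) / √220`. -/
noncomputable def vecB : Fin 4 → ℝ := fun i =>
  (1 / (2 * √55)) * (![1, 3 * √3, 6 * √3, 2 * √21] : Fin 4 → ℝ) i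

/-- The unit vector `c`, orthogonal to `b`. -/
noncomputable def vecC : Fin 4 → ℝ := fun i =>
  (1 / (2 * √110)) * (![6 * √3, 10, -13, 3 * √7] : Fin 4 → ℝ) i

/-- The coefficients `α = (√13 / 11) b + (6 √3 / 11) c`. -/
noncomputable def labelCoeff : Fin 4 → ℝ := fun i => (√13 / 11) * vecB i + (6 * √3 / 11) * vecC i

/-- The vectors `φ_v = ∑ᵢ (αᵢ / √|Dᵢ(v)|) ∑_{w ∈ Dᵢ(v)} |w⟩` in `ℝ^220`. -/
noncomputable def labelVector (v : Triple) : EuclideanSpace ℝ Triple :=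
  ∑ i : Fin 4, (labelCoeff i / √((tripleSphere i v).card : ℝ)) •
    ∑ w ∈ tripleSphere i v, EuclideanSpace.single w (1 : ℝ)

/-- The vector `Ψ = (1 / √220) ∑_w |w⟩` in `ℝ^220`. -/
noncomputable def handleVector : EuclideanSpace ℝ Triple :=
  (1 / √220) • ∑ w : Triple, EuclideanSpace.single w (1 : ℝ)

/-! The violating set is the diagonal `{(v, v)}`. Two distinct triples either share an edge of
`J₁₂`, or are adjacent in `NO(J₁₂)` and then share an edge of `H_B`; in both cases the diagonal
vertices share an edge of the product. The diagonal is thus independent, and its total weight is 220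
· (1/12) · (13/121) = 65/33 > 1.

That `modelA` survives every tensor power is Haemers' rank bound. The incidence vectors of triples
over 𝔽₂ are orthogonal along edges and have self-product 1. Such representations multiply under
products, so independent sets of the `n`-th power have at most `12 ^ n` vertices, each of weight
`12⁻ⁿ` (`HasBinaryRep.card_le`).

Quantum models survive because the Hilbert–Schmidt vectors `√ρ` and `P v √ρ` form a vector
representation, a notion that also multiplies; Cauchy–Schwarz bounds the weight of an independent
set by 1. `modelB` is quantum: measure the pure state `Ψ` with the rank-one projections onto the
`φ_v`.

The Lovász number comes from duality: for labelings `φ` of the complement and `ψ` of the graph the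
vectors `φ_v ⊗ ψ_v` are orthonormal, and Bessel's inequality gives both bounds. The adjacency matrix
`A` of `NO(J₁₂)` has least eigenvalue -13. Up to scaling, `φ` is a constant plus the projection onto
that eigenspace, while the dual labeling has Gram matrix `1 + A / 13`, which kills it. -/

namespace ContextualityScenario

/-! ### Orthogonality and models in Foulis–Randall products -/

section General

variable {V W : Type} {HA : ContextualityScenario V} {HB : ContextualityScenario W}

/-- Two distinct vertices of a Foulis-Randall product that share an edge have distinct components
sharing an edge, on one of the two sides. -/
theorem exists_edge_of_exists_edge_prod {x y : V × W} (hxy : x ≠ y)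
    (h : ∃ e ∈ (HA.prod HB).edges, x ∈ e ∧ y ∈ e) :
    (x.1 ≠ y.1 ∧ ∃ e ∈ HA.edges, x.1 ∈ e ∧ y.1 ∈ e) ∨
      (x.2 ≠ y.2 ∧ ∃ e ∈ HB.edges, x.2 ∈ e ∧ y.2 ∈ e) := by
  obtain ⟨e, he | he, hx, hy⟩ := h
  · obtain ⟨eA, hA, f, hf, hmem⟩ := he
    rw [hmem] at hx hy
    by_cases h1 : x.1 = y.1
    · exact Or.inr ⟨fun h2 => hxy (Prod.ext h1 h2), f x.1, hf _ hx.1, hx.2, h1 ▸ hy.2⟩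
    · exact Or.inl ⟨h1, eA, hA, hx.1, hy.1⟩
  · obtain ⟨eB, hB, f, hf, hmem⟩ := he
    rw [hmem] at hx hy
    by_cases h2 : x.2 = y.2
    · exact Or.inl ⟨fun h1 => hxy (Prod.ext h1 h2), f x.2, hf _ hx.1, hx.2, h2 ▸ hy.2⟩
    · exact Or.inr ⟨h2, eB, hB, hx.1, hy.1⟩

/-- As `a ≠ a'`, the edges of `HB` placed over `a` and `a'` can be chosen independently, one through
`b` and one through `b'`; so nothing is asked of `b` and `b'`. -/
theorem exists_edge_prod_of_fst {a a' : V} (b b' : W) (ha : a ≠ a')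
    (h : ∃ e ∈ HA.edges, a ∈ e ∧ a' ∈ e) :
    ∃ e ∈ (HA.prod HB).edges, (a, b) ∈ e ∧ (a', b') ∈ e := by
  classical
  have := HA.finite
  have := HB.finite
  have := Fintype.ofFinite V
  have := Fintype.ofFinite W
  obtain ⟨e, he, h1, h2⟩ := h
  obtain ⟨f, hf, hb⟩ := HB.cover b
  obtain ⟨f', hf', hb'⟩ := HB.cover b'
  let g : V → Finset W := fun x => if x = a then f else f'
  refine ⟨Finset.univ.filter fun x : V × W => x.1 ∈ e ∧ x.2 ∈ g x.1,
    Or.inl ⟨e, he, g, fun x _ => ?_, by simp⟩, ?_, ?_⟩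
  · by_cases hx : x = a <;> simp [g, hx, hf, hf']
  · simp [g, h1, hb]
  · simp [g, h2, hb', ha.symm]

theorem exists_edge_prod_of_snd (a a' : V) {b b' : W} (hb : b ≠ b')
    (h : ∃ e ∈ HB.edges, b ∈ e ∧ b' ∈ e) :
    ∃ e ∈ (HA.prod HB).edges, (a, b) ∈ e ∧ (a', b') ∈ e := by
  classical
  have := HA.finite
  have := HB.finite
  have := Fintype.ofFinite V
  have := Fintype.ofFinite W
  obtain ⟨e, he, h1, h2⟩ := h
  obtain ⟨f, hf, ha⟩ := HA.cover a
  obtain ⟨f', hf', ha'⟩ := HA.cover a'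
  let g : W → Finset V := fun x => if x = b then f else f'
  refine ⟨Finset.univ.filter fun x : V × W => x.2 ∈ e ∧ x.1 ∈ g x.2,
    Or.inr ⟨e, he, g, fun x _ => ?_, by simp⟩, ?_, ?_⟩
  · by_cases hx : x = b <;> simp [g, hx, hf, hf']
  · simp [g, h1, ha]
  · simp [g, h2, ha', hb.symm]

theorem tensor_mem_probModels {pA : V → ℝ} {pB : W → ℝ} (hA : pA ∈ HA.probModels)
    (hB : pB ∈ HB.probModels) : tensor pA pB ∈ (HA.prod HB).probModels := by
  refine ⟨fun x => ⟨mul_nonneg (hA.1 _).1 (hB.1 _).1,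
    mul_le_one₀ (hA.1 _).2 (hB.1 _).1 (hB.1 _).2⟩, ?_⟩
  rintro e (⟨eA, heA, f, hf, he⟩ | ⟨eB, heB, f, hf, he⟩)
  · rw [Finset.sum_finset_product e eA f he, ← hA.2 eA heA]
    refine Finset.sum_congr rfl fun a ha => ?_
    simp only [tensor]
    rw [← Finset.mul_sum, hB.2 _ (hf a ha), mul_one]
  · rw [Finset.sum_finset_product_right e eB f he, ← hB.2 eB heB]
    refine Finset.sum_congr rfl fun b hb => ?_
    simp only [tensor]
    rw [← Finset.sum_mul, hA.2 _ (hf b hb), one_mul]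

theorem tensorPow_mem_probModels {p : V → ℝ} (hp : p ∈ HA.probModels) :
    ∀ n, tensorPow p n ∈ (HA.pow n).probModels
  | 0 => by
    refine ⟨fun _ => ⟨zero_le_one, le_rfl⟩, fun e he => ?_⟩
    have : e = ({()} : Finset Unit) := Finset.ext fun x => 
      ⟨fun _ => Finset.mem_singleton.2 rfl, fun _ => he x⟩
    subst this
    exact Finset.sum_singleton _ _
  | 1 => hp
  | n + 2 => tensor_mem_probModels (tensorPow_mem_probModels hp (n + 1)) hp

/-! ### Vector representations and Consistent Exclusivity -/

/-- A vector representation of `p`: a unit vector `Ψ` and vectors `x v`, orthogonal for distinct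
vertices sharing an edge, with `⟨Ψ, x v⟩ = ‖x v‖² = p v`. -/
def HasVectorRep (H : ContextualityScenario V) (p : V → ℝ) : Prop :=
  ∃ (E : Type) (_ : NormedAddCommGroup E) (_ : InnerProductSpace ℂ E) (Ψ : E) (x : V → E),
    ‖Ψ‖ = 1 ∧ (∀ v, ⟪Ψ, x v⟫_ℂ = (p v : ℂ)) ∧ (∀ v, ⟪x v, x v⟫_ℂ = (p v : ℂ)) ∧
    ∀ u v, u ≠ v → (∃ e ∈ H.edges, u ∈ e ∧ v ∈ e) → ⟪x u, x v⟫_ℂ = 0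

open scoped TensorProduct in
theorem HasVectorRep.tensor {pA : V → ℝ} {pB : W → ℝ} (hA : HA.HasVectorRep pA)
    (hB : HB.HasVectorRep pB) : (HA.prod HB).HasVectorRep (tensor pA pB) := by
  obtain ⟨E, _, _, Ψ, x, h1, h2, h3, h4⟩ := hA
  obtain ⟨F, _, _, Φ, y, k1, k2, k3, k4⟩ := hB
  refine ⟨E ⊗[ℂ] F, inferInstance, inferInstance, Ψ ⊗ₜ Φ, fun v => x v.1 ⊗ₜ y v.2, ?_,
    fun v => ?_, fun v => ?_, fun u v huv h => ?_⟩
  · simp [h1, k1]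
  · simp [h2, k2, ContextualityScenario.tensor]
  · simp [TensorProduct.inner_tmul, h3, k3, ContextualityScenario.tensor,
      -inner_self_eq_norm_sq_to_K]
  · rw [TensorProduct.inner_tmul]
    rcases exists_edge_of_exists_edge_prod huv h with ⟨h, h'⟩ | ⟨h, h'⟩
    · rw [h4 _ _ h h', zero_mul]
    · rw [k4 _ _ h h', mul_zero]

theorem HasVectorRep.tensorPow {p : V → ℝ} (hp : HA.HasVectorRep p) :
    ∀ n, (HA.pow n).HasVectorRep (tensorPow p n)
  | 0 => ⟨ℂ, inferInstance, inferInstance, 1, fun _ => 1, by simp,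
      fun _ => by simp [ContextualityScenario.tensorPow],
      fun _ => by simp [ContextualityScenario.tensorPow],
      fun u v huv => absurd (Subsingleton.elim (α := Unit) u v) huv⟩
  | 1 => hp
  | n + 2 => (HasVectorRep.tensorPow hp (n + 1)).tensor hp

/-- Independent vertices pairwise share an edge, so their vectors are orthogonal. Their sum `S` then
satisfies `⟨Ψ, S⟩ = ‖S‖² = s`, and Cauchy–Schwarz gives `s ≤ √s`. -/
theorem HasVectorRep.sum_le_one {p : V → ℝ} (hp : HA.HasVectorRep p) (I : Finset V)
    (hI : HA.nonOrthGraph.IsIndepSet (I : Set V)) : ∑ v ∈ I, p v ≤ 1 := by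
  obtain ⟨E, _, _, Ψ, x, h1, h2, h3, h4⟩ := hp
  set s := ∑ v ∈ I, p v with hs
  have hΨ : ⟪Ψ, ∑ v ∈ I, x v⟫_ℂ = (s : ℂ) := by
    rw [inner_sum, hs, Complex.ofReal_sum]
    exact Finset.sum_congr rfl fun v _ => h2 v
  have hx : ⟪∑ v ∈ I, x v, ∑ v ∈ I, x v⟫_ℂ = (s : ℂ) := by
    rw [sum_inner, hs, Complex.ofReal_sum]
    refine Finset.sum_congr rfl fun u hu => ?_
    rw [inner_sum, Finset.sum_eq_single_of_mem u hu, h3]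
    exact fun v hv hvu => h4 _ _ hvu.symm (not_not.1 (hI hu hv hvu.symm))
  have hn : ‖∑ v ∈ I, x v‖ ^ 2 = s := by
    rw [inner_self_eq_norm_sq_to_K] at hx
    exact Complex.ofReal_injective (by simpa using hx)
  have hc := norm_inner_le_norm (𝕜 := ℂ) Ψ (∑ v ∈ I, x v)
  rw [hΨ, h1, one_mul, Complex.norm_real, Real.norm_eq_abs] at hc
  have hs0 : 0 ≤ s := hn ▸ sq_nonneg _
  rw [abs_of_nonneg hs0] at hc
  nlinarith

theorem HasVectorRep.mem_consistentExclusivityInf {p : V → ℝ} (hp : HA.HasVectorRep p)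
    (h : p ∈ HA.probModels) : p ∈ HA.consistentExclusivityInf :=
  Set.mem_iInter.2 fun n => ⟨h, tensorPow_mem_probModels h n, (hp.tensorPow n).sum_le_one⟩

/-! ### The Haemers bound over 𝔽₂ -/

/-- A representation of the scenario over `𝔽₂` in the sense of Haemers: vectors with `m` coordinates
and `x v ⬝ x v = 1`, orthogonal for distinct vertices sharing an edge. -/
def HasBinaryRep (H : ContextualityScenario V) (m : ℕ) : Prop :=
  ∃ (κ : Type) (_ : Fintype κ) (x : V → κ → ZMod 2), Fintype.card κ = m ∧
    (∀ v, x v ⬝ᵥ x v = 1) ∧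
    ∀ u v, u ≠ v → (∃ e ∈ H.edges, u ∈ e ∧ v ∈ e) → x u ⬝ᵥ x v = 0

theorem HasBinaryRep.prod {m n : ℕ} (hA : HA.HasBinaryRep m) (hB : HB.HasBinaryRep n) :
    (HA.prod HB).HasBinaryRep (m * n) := by
  obtain ⟨κ, _, x, h1, h2, h3⟩ := hA
  obtain ⟨μ, _, y, k1, k2, k3⟩ := hB
  have key : ∀ u v : V × W, (fun i : κ × μ => x u.1 i.1 * y u.2 i.2) ⬝ᵥ
      (fun i : κ × μ => x v.1 i.1 * y v.2 i.2) = (x u.1 ⬝ᵥ x v.1) * (y u.2 ⬝ᵥ y v.2) := by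
    intro u v
    simp only [dotProduct, Fintype.sum_prod_type, Finset.sum_mul_sum]
    exact Finset.sum_congr rfl fun i _ => Finset.sum_congr rfl fun j _ => by ring
  refine ⟨κ × μ, inferInstance, fun v i => x v.1 i.1 * y v.2 i.2, ?_, fun v => ?_,
    fun u v huv h => ?_⟩
  · rw [Fintype.card_prod, h1, k1]
  · rw [key, h2, k2, mul_one]
  · rw [key]
    rcases exists_edge_of_exists_edge_prod huv h with ⟨h, h'⟩ | ⟨h, h'⟩
    · rw [h3 _ _ h h', zero_mul]
    · rw [k3 _ _ h h', mul_zero]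

theorem HasBinaryRep.pow {m : ℕ} (h : HA.HasBinaryRep m) : ∀ n, (HA.pow n).HasBinaryRep (m ^ n)
  | 0 => ⟨Unit, inferInstance, fun _ _ => 1, by simp, fun _ => by simp [dotProduct],
      fun u v huv => absurd (Subsingleton.elim (α := Unit) u v) huv⟩
  | 1 => by rw [pow_one]; exact h
  | n + 2 => by rw [pow_succ]; exact (HasBinaryRep.pow h (n + 1)).prod h

/-- The vectors of an independent set are pairwise orthogonal with self-product 1. Pairing a linear
relation with one of them isolates its coefficient, so they are linearly independent in dimension
`m`. -/
theorem HasBinaryRep.card_le {m : ℕ} (h : HA.HasBinaryRep m) (I : Finset V)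
    (hI : HA.nonOrthGraph.IsIndepSet (I : Set V)) : I.card ≤ m := by
  obtain ⟨κ, _, x, rfl, h2, h3⟩ := h
  have hli : LinearIndependent (ZMod 2) fun v : I => x v := by
    rw [Fintype.linearIndependent_iff]
    intro g hg u
    have h0 : (∑ v : I, g v • x v) ⬝ᵥ x u = 0 := by rw [hg, zero_dotProduct]
    rw [sum_dotProduct, Finset.sum_eq_single_of_mem u (Finset.mem_univ _), smul_dotProduct, h2,
      smul_eq_mul, mul_one] at h0
    · exact h0
    · intro v _ hvu
      have hvu' : (v : V) ≠ u := fun h => hvu (Subtype.ext h)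
      rw [smul_dotProduct, h3 _ _ hvu' (not_not.1 (hI v.2 u.2 hvu')), smul_zero]
  simpa using hli.fintype_card_le_finrank

end General

theorem tensorPow_const {V : Type} (c : ℝ) : ∀ (n : ℕ) (v : PowVertex V n),
    tensorPow (fun _ : V => c) n v = c ^ n
  | 0, _ => (pow_zero c).symm
  | 1, _ => (pow_one c).symm
  | n + 2, v => by
    rw [pow_succ, ← tensorPow_const c (n + 1) v.1]
    rfl

theorem HasBinaryRep.const_mem_consistentExclusivityInf {V : Type} {H : ContextualityScenario V}
    {m : ℕ} (hm : 0 < m) (h : H.HasBinaryRep m) (hp : (fun _ => 1 / (m : ℝ)) ∈ H.probModels) :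
    (fun _ => 1 / (m : ℝ)) ∈ H.consistentExclusivityInf := by
  refine Set.mem_iInter.2 fun n => ⟨hp, tensorPow_mem_probModels hp n, fun I hI => ?_⟩
  have hc : (I.card : ℝ) ≤ (m : ℝ) ^ n := by exact_mod_cast (h.pow n).card_le I hI
  have hm' : (0 : ℝ) < (m : ℝ) ^ n := by positivity
  simp only [tensorPow_const]
  rw [Finset.sum_const, nsmul_eq_mul, one_div, inv_pow, ← div_eq_mul_inv]
  exact div_le_one_of_le₀ hc hm'.le

end ContextualityScenario

/-! ### Hilbert–Schmidt sums and cyclicity of the trace -/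

section HilbertSchmidt

variable {K : Type} [NormedAddCommGroup K] [InnerProductSpace ℂ K]

theorem inner_self_eq_ofReal_norm_sq (x : K) : ⟪x, x⟫_ℂ = ((‖x‖ ^ 2 : ℝ) : ℂ) := by
  simp [inner_self_eq_norm_sq_to_K]

theorem IsStarProjection.inner_apply_left [CompleteSpace K] {P : K →L[ℂ] K}
    (hP : IsStarProjection P) (x y : K) : ⟪P x, y⟫_ℂ = ⟪x, P y⟫_ℂ := by
  have := ContinuousLinearMap.adjoint_inner_left P y x
  rwa [← ContinuousLinearMap.star_eq_adjoint, hP.isSelfAdjoint.star_eq] at this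

theorem IsStarProjection.apply_apply [CompleteSpace K] {P : K →L[ℂ] K}
    (hP : IsStarProjection P) (x : K) : P (P x) = P x := by
  conv_rhs => rw [← hP.isIdempotentElem.eq]
  rfl

theorem IsStarProjection.inner_apply_self [CompleteSpace K] {P : K →L[ℂ] K}
    (hP : IsStarProjection P) (x : K) : ⟪x, P x⟫_ℂ = ((‖P x‖ ^ 2 : ℝ) : ℂ) := by
  rw [← hP.apply_apply, ← hP.inner_apply_left, hP.apply_apply, inner_self_eq_ofReal_norm_sq]

theorem HilbertBasis.hasSum_norm_inner_sq {ι : Type} (b : HilbertBasis ι ℂ K) (x : K) :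
    HasSum (fun i => ‖⟪b i, x⟫_ℂ‖ ^ 2) (‖x‖ ^ 2) := by
  have h := b.hasSum_inner_mul_inner x x
  rw [inner_self_eq_ofReal_norm_sq] at h
  refine Complex.hasSum_ofReal.1 ?_
  refine (congrArg (fun f => HasSum f _) (funext fun i => ?_)).mpr h
  rw [← inner_conj_symm x (b i), ← Complex.normSq_eq_conj_mul_self, Complex.normSq_eq_norm_sq]

/-- Passing to `ℝ≥0∞` lets double sums be exchanged with no summability condition. -/
theorem hasSum_iff_tsum_ofReal {ι : Type} {f : ι → ℝ} (hf : ∀ i, 0 ≤ f i) {a : ℝ} (ha : 0 ≤ a) :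
    HasSum f a ↔ ∑' i, ENNReal.ofReal (f i) = ENNReal.ofReal a := by
  constructor
  · intro h
    rw [← h.tsum_eq, ENNReal.ofReal_tsum_of_nonneg hf h.summable]
  · intro h
    have hs : Summable f := by
      have h1 := ENNReal.summable_toReal (f := fun i => ENNReal.ofReal (f i))
        (by rw [h]; exact ENNReal.ofReal_ne_top)
      simpa only [ENNReal.toReal_ofReal (hf _)] using h1
    rw [← ENNReal.ofReal_tsum_of_nonneg hf hs,
      ENNReal.ofReal_eq_ofReal_iff (tsum_nonneg hf) ha] at h
    exact h ▸ hs.hasSum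

/-- An operator and its adjoint have the same Hilbert–Schmidt norm: both squares are the double sum
of the squared matrix entries, summed in either order. -/
theorem HilbertBasis.hasSum_norm_adjoint_sq [CompleteSpace K] {ι : Type} (b : HilbertBasis ι ℂ K)
    {T S : K →L[ℂ] K} (hTS : ∀ x y, ⟪T x, y⟫_ℂ = ⟪x, S y⟫_ℂ) {a : ℝ}
    (h : HasSum (fun i => ‖T (b i)‖ ^ 2) a) : HasSum (fun i => ‖S (b i)‖ ^ 2) a := by
  have ha : 0 ≤ a := h.nonneg fun i => sq_nonneg _
  have expand : ∀ x, ENNReal.ofReal (‖x‖ ^ 2) = ∑' j, ENNReal.ofReal (‖⟪b j, x⟫_ℂ‖ ^ 2) := fun x =>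
    ((hasSum_iff_tsum_ofReal (fun _ => sq_nonneg _) (sq_nonneg _)).1
      (b.hasSum_norm_inner_sq x)).symm
  rw [hasSum_iff_tsum_ofReal (fun _ => sq_nonneg _) ha] at h ⊢
  rw [← h]
  simp only [expand]
  rw [ENNReal.tsum_comm]
  refine tsum_congr fun j => tsum_congr fun i => ?_
  rw [← hTS, ← inner_conj_symm, RCLike.norm_conj]

/-- Cyclicity of the trace: `tr (s s P) = ∑ i, ‖P s bᵢ‖²`. -/
theorem hasSum_norm_projection_sqrt [CompleteSpace K] {ι : Type} (b : HilbertBasis ι ℂ K)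
    {s P : K →L[ℂ] K} (hs : ∀ x y, ⟪s x, y⟫_ℂ = ⟪x, s y⟫_ℂ) (hP : IsStarProjection P) {t p : ℝ}
    (ht : HasSum (fun i => ‖s (b i)‖ ^ 2) t)
    (hp : HasSum (fun i => ⟪b i, (s * s * P) (b i)⟫_ℂ) (p : ℂ)) :
    HasSum (fun i => ‖P (s (b i))‖ ^ 2) p := by
  have hPs := hP.inner_apply_left
  have hre : ∀ x, (⟪x, P x⟫_ℂ).re = ‖P x‖ ^ 2 := fun x => by
    rw [hP.inner_apply_self, Complex.ofReal_re]
  have hle : ∀ x, ‖P x‖ ≤ ‖x‖ := fun x => by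
    have h1 := Complex.re_le_norm ⟪x, P x⟫_ℂ
    have h2 := norm_inner_le_norm (𝕜 := ℂ) x (P x)
    rw [hre] at h1
    by_contra! h
    nlinarith [norm_nonneg x, norm_nonneg (P x)]
  obtain ⟨a, ha⟩ : Summable fun i => ‖P (s (b i))‖ ^ 2 :=
    ht.summable.of_nonneg_of_le (fun _ => sq_nonneg _) fun i => by gcongr; exact hle _
  have hc : ∀ x y, ⟪(P * s) x, y⟫_ℂ = ⟪x, (s * P) y⟫_ℂ := fun x y => by
    change ⟪P (s x), y⟫_ℂ = ⟪x, s (P y)⟫_ℂ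
    rw [hPs, hs]
  have ha' : HasSum (fun i => ‖s (P (b i))‖ ^ 2) a := b.hasSum_norm_adjoint_sq hc ha
  have hp' : HasSum (fun i => (⟪s (b i), s (P (b i))⟫_ℂ).re) p := by
    refine (congrArg (fun f => HasSum f _) (funext fun i => ?_)).mpr (Complex.hasSum_re hp)
    rw [hs]
    rfl
  -- The adjoint operators `s + sP` and `s + Ps` have equal Hilbert–Schmidt norms. The cross term is
  -- `2p` for the first and `2a` for the second, since `⟨y, P y⟩ = ‖P y‖²`. Hence `t + 2p + a = t +
  -- 3a`.
  have h1 : HasSum (fun i => ‖(s + s * P) (b i)‖ ^ 2) (t + 2 * p + a) := by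
    convert (ht.add (hp'.mul_left 2)).add ha' using 1
    ext i
    change ‖s (b i) + s (P (b i))‖ ^ 2 = _
    rw [norm_add_sq (𝕜 := ℂ)]
    rfl
  have h2 : HasSum (fun i => ‖(s + P * s) (b i)‖ ^ 2) (t + 3 * a) := by
    convert ht.add (ha.mul_left 3) using 1
    ext i
    change ‖s (b i) + P (s (b i))‖ ^ 2 = _
    rw [norm_add_sq (𝕜 := ℂ)]
    have := hre (s (b i))
    simp only [RCLike.re_to_complex] at *
    rw [this]
    ring
  have h3 := b.hasSum_norm_adjoint_sq (S := s + s * P) (fun x y => by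
    rw [add_apply, add_apply, inner_add_left,
      inner_add_right, hs, hc]) h2
  have : p = a := by linarith [h1.unique h3]
  rwa [this]

/-- Projections that sum to the identity are pairwise orthogonal. -/
theorem IsStarProjection.inner_eq_zero_of_sum_eq_one [CompleteSpace K] {ι : Type} {e : Finset ι}
    {P : ι → K →L[ℂ] K} (hP : ∀ i, IsStarProjection (P i)) (he : ∑ i ∈ e, P i = 1) {u v : ι}
    (hu : u ∈ e) (hv : v ∈ e) (huv : u ≠ v) (x y : K) : ⟪P u x, P v y⟫_ℂ = 0 := by
  classical
  have hre : ∀ i x, (⟪x, P i x⟫_ℂ).re = ‖P i x‖ ^ 2 := fun i x => by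
    rw [(hP i).inner_apply_self, Complex.ofReal_re]
  -- The squares `‖P i (P u x)‖²` over the edge sum to `‖P u x‖²`, which the term `i = u` already
  -- exhausts.
  have hz : P v (P u x) = 0 := by
    have h1 : ∑ i ∈ e, ‖P i (P u x)‖ ^ 2 = ‖P u x‖ ^ 2 := by
      have h2 : ∑ i ∈ e, P i (P u x) = P u x := by
        rw [← sum_apply, he]
        rfl
      simp only [← hre]
      rw [← Complex.re_sum, ← inner_sum, h2, inner_self_eq_ofReal_norm_sq, Complex.ofReal_re,
        (hP u).inner_apply_self, Complex.ofReal_re]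
    rw [← Finset.add_sum_erase e _ hu, (hP u).apply_apply] at h1
    have h3 := (Finset.sum_eq_zero_iff_of_nonneg fun i _ => sq_nonneg ‖P i (P u x)‖).1
      (show ∑ i ∈ e.erase u, ‖P i (P u x)‖ ^ 2 = 0 by linarith) v
      (Finset.mem_erase.2 ⟨huv.symm, hv⟩)
    simpa using h3
  rw [← (hP v).inner_apply_left, hz, inner_zero_left]

end HilbertSchmidt

/-! ### Quantum models satisfy Consistent Exclusivity at every level -/

namespace ContextualityScenario

variable {V : Type} {H : ContextualityScenario V}

/-- Hilbert–Schmidt operators are modelled as square-summable families of their values on a Hilbert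
basis: `Ψ` is the family of `√ρ` and the vector of `v` is that of `P v √ρ`. Cyclicity of the trace
gives it squared norm `tr (ρ P v) = p v`. -/
theorem mem_probModels_and_hasVectorRep_of_mem_quantumModels {p : V → ℝ}
    (hp : p ∈ H.quantumModels) : p ∈ H.probModels ∧ H.HasVectorRep p := by
  obtain ⟨K, _, _, _, ρ, P, hρ, hρ1, hP, he, hpP⟩ := hp
  obtain ⟨w, b, -⟩ := exists_hilbertBasis ℂ K
  set s : K →L[ℂ] K := CFC.sqrt ρ with hsdef
  have hss : s * s = ρ :=
    CFC.sqrt_mul_sqrt_self ρ ((ContinuousLinearMap.nonneg_iff_isPositive ρ).2 hρ)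
  have hs : ∀ x y, ⟪s x, y⟫_ℂ = ⟪x, s y⟫_ℂ :=
    ((ContinuousLinearMap.nonneg_iff_isPositive s).1 (CFC.sqrt_nonneg ρ)).isSymmetric
  have ht : HasSum (fun i => ‖s (b i)‖ ^ 2) 1 := by
    have h1 := hρ1 w b
    rw [← hss] at h1
    refine Complex.hasSum_ofReal.1 ?_
    rw [Complex.ofReal_one]
    refine (congrArg (fun f => HasSum f _) (funext fun i => ?_)).mpr h1
    rw [← inner_self_eq_ofReal_norm_sq, hs]
    rfl
  have hPs : ∀ v, HasSum (fun i => ‖P v (s (b i))‖ ^ 2) (p v) := fun v =>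
    hasSum_norm_projection_sqrt b hs (hP v) ht (by rw [hss]; exact hpP v w b)
  have hsum : ∀ e ∈ H.edges, ∑ v ∈ e, p v = 1 := fun e hee => by
    have h1 := hasSum_sum fun v (_ : v ∈ e) => hpP v w b
    have h2 : HasSum (fun i => ∑ v ∈ e, ⟪b i, (ρ * P v) (b i)⟫_ℂ) 1 := by
      convert hρ1 w b using 2 with i
      rw [← inner_sum, ← sum_apply, ← Finset.mul_sum, he e hee, mul_one]
    exact_mod_cast h1.unique h2
  have h0 : ∀ v, 0 ≤ p v := fun v => (hPs v).nonneg fun _ => sq_nonneg _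
  have hmem : ∀ {f : w → K}, (Summable fun i => ‖f i‖ ^ 2) → Memℓp f 2 := fun hf => by
    rw [memℓp_gen_iff (by norm_num)]
    simpa using hf
  have hself : ∀ (f : w → K) (hf : Memℓp f 2) (a : ℝ), HasSum (fun i => ‖f i‖ ^ 2) a →
      ⟪(⟨f, hf⟩ : lp (fun _ : w => K) 2), ⟨f, hf⟩⟫_ℂ = (a : ℂ) := fun f hf a ha => by
    refine (lp.hasSum_inner (𝕜 := ℂ) (⟨f, hf⟩ : lp (fun _ : w => K) 2) ⟨f, hf⟩).unique ?_
    refine (congrArg (fun f => HasSum f _) (funext fun i => ?_)).mpr (Complex.hasSum_ofReal.2 ha)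
    exact inner_self_eq_ofReal_norm_sq _
  refine ⟨⟨fun v => ⟨h0 v, ?_⟩, hsum⟩, ?_⟩
  · obtain ⟨e, hee, hv⟩ := H.cover v
    rw [← hsum e hee]
    exact Finset.single_le_sum (fun u _ => h0 u) hv
  · refine ⟨lp (fun _ : w => K) 2, inferInstance, inferInstance,
      ⟨fun i => s (b i), hmem ht.summable⟩, fun v => ⟨fun i => P v (s (b i)), hmem (hPs v).summable⟩,
      ?_, fun v => ?_, fun v => hself _ _ _ (hPs v), fun u v huv ⟨e, hee, hu, hv⟩ => ?_⟩
    · have h1 := hself _ (hmem ht.summable) _ ht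
      rw [inner_self_eq_ofReal_norm_sq, Complex.ofReal_inj] at h1
      exact (pow_eq_one_iff_of_nonneg (norm_nonneg _) two_ne_zero).1 h1
    · rw [← hself _ (hmem (hPs v).summable) _ (hPs v), lp.inner_eq_tsum, lp.inner_eq_tsum]
      refine tsum_congr fun i => ?_
      change ⟪s (b i), P v (s (b i))⟫_ℂ = ⟪P v (s (b i)), P v (s (b i))⟫_ℂ
      rw [(hP v).inner_apply_left, (hP v).apply_apply]
    · rw [lp.inner_eq_tsum]
      refine (tsum_congr fun i => ?_).trans tsum_zero
      exact IsStarProjection.inner_eq_zero_of_sum_eq_one hP (he e hee) hu hv huv _ _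

theorem quantumModels_subset_probModels : H.quantumModels ⊆ H.probModels :=
  fun _ hp => (mem_probModels_and_hasVectorRep_of_mem_quantumModels hp).1

theorem quantumModels_subset_consistentExclusivityInf :
    H.quantumModels ⊆ H.consistentExclusivityInf := fun _ hp =>
  have h := mem_probModels_and_hasVectorRep_of_mem_quantumModels hp
  h.2.mem_consistentExclusivityInf h.1

end ContextualityScenario

/-! ### Orthogonality in `J₁₂` and the model `modelA` -/

theorem exists_quad_partition_of_disjoint {s t : Finset (Fin 12)} (hs : s.card = 4)
    (ht : t.card = 4) (hst : Disjoint s t) :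
    ∃ P : Finpartition (Finset.univ : Finset (Fin 12)),
      (∀ t ∈ P.parts, t.card = 4) ∧ s ∈ P.parts ∧ t ∈ P.parts := by
  have hr : ((s ∪ t)ᶜ).card = 4 := by
    rw [Finset.card_compl, Finset.card_union_of_disjoint hst, hs, ht]
    rfl
  have hsr : Disjoint s (s ∪ t)ᶜ := disjoint_compl_right.mono_left Finset.subset_union_left
  have htr : Disjoint t (s ∪ t)ᶜ := disjoint_compl_right.mono_left Finset.subset_union_right
  have hcard : ∀ a ∈ ({s, t, (s ∪ t)ᶜ} : Finset (Finset (Fin 12))), a.card = 4 := by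
    intro a ha
    simp only [Finset.mem_insert, Finset.mem_singleton] at ha
    rcases ha with rfl | rfl | rfl <;> assumption
  refine ⟨{ parts := {s, t, (s ∪ t)ᶜ}, supIndep := ?_, sup_parts := ?_, bot_notMem := ?_ },
    hcard, by simp, by simp⟩
  · rw [Finset.supIndep_iff_pairwiseDisjoint]
    intro a ha b hb hab
    simp only [Finset.coe_insert, Finset.coe_singleton, Set.mem_insert_iff,
      Set.mem_singleton_iff] at ha hb
    rcases ha with rfl | rfl | rfl <;> rcases hb with rfl | rfl | rfl <;>
      first
      | exact absurd rfl hab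
      | assumption
      | exact Disjoint.symm (by assumption)
  · simp only [Finset.sup_insert, Finset.sup_singleton, id, Finset.sup_eq_union]
    rw [← Finset.union_assoc, Finset.union_compl]
  · intro h
    simpa using hcard _ h

theorem Triple.card_inter_eq_three {v w : Triple} (h : (v.1 ∩ w.1).card = 3) : v = w := by
  have h1 : v.1 ∩ w.1 = v.1 :=
    Finset.eq_of_subset_of_card_le Finset.inter_subset_left (by rw [h, v.2])
  have h2 : v.1 ∩ w.1 = w.1 :=
    Finset.eq_of_subset_of_card_le Finset.inter_subset_right (by rw [h, w.2])
  exact Subtype.ext (h1.symm.trans h2)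

theorem Triple.card_inter_le (v w : Triple) : (v.1 ∩ w.1).card ≤ 3 :=
  (Finset.card_le_card Finset.inter_subset_left).trans_eq v.2

/-- Triples in one four-element part meet in at least two points, and triples in different parts are
disjoint. Conversely, disjoint triples extend to disjoint quadruples, and two triples with two
common points have a quadruple as their union. -/
theorem scenarioJ12_exists_edge_iff (v w : Triple) :
    (∃ e ∈ scenarioJ12.edges, v ∈ e ∧ w ∈ e) ↔ (v.1 ∩ w.1).card ≠ 1 := by
  constructor
  · rintro ⟨e, ⟨P, hP, he⟩, hve, hwe⟩ h
    obtain ⟨a, ha, hva⟩ := (he _).1 hve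
    obtain ⟨b, hb, hwb⟩ := (he _).1 hwe
    obtain ⟨x, hx⟩ := Finset.card_pos.1 (show 0 < (v.1 ∩ w.1).card by omega)
    rw [Finset.mem_inter] at hx
    obtain rfl : a = b := P.eq_of_mem_parts ha hb (hva hx.1) (hwb hx.2)
    have h1 := Finset.card_le_card (Finset.union_subset hva hwb)
    have h2 := Finset.card_union_add_card_inter v.1 w.1
    rw [hP a ha] at h1
    rw [v.2, w.2] at h2
    omega
  · intro h
    have mk : ∀ P : Finpartition (Finset.univ : Finset (Fin 12)), (∀ t ∈ P.parts, t.card = 4) →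
        (∃ t ∈ P.parts, v.1 ⊆ t) → (∃ t ∈ P.parts, w.1 ⊆ t) →
        ∃ e ∈ scenarioJ12.edges, v ∈ e ∧ w ∈ e := fun P hP hv hw =>
      ⟨Finset.univ.filter fun u : Triple => ∃ t ∈ P.parts, u.1 ⊆ t, ⟨P, hP, by simp⟩,
        by simpa using hv, by simpa using hw⟩
    have hle := Triple.card_inter_le v w
    have hun := Finset.card_union_add_card_inter v.1 w.1
    rw [v.2, w.2] at hun
    have hcases : (v.1 ∩ w.1).card = 0 ∨ (v.1 ∩ w.1).card = 2 ∨ (v.1 ∩ w.1).card = 3 := by omega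
    rcases hcases with h0 | h2 | h3
    · have hd : Disjoint v.1 w.1 := Finset.disjoint_iff_inter_eq_empty.2 (Finset.card_eq_zero.1 h0)
      obtain ⟨s, hvs, hsw, hs⟩ := Finset.exists_subsuperset_card_eq
        (show v.1 ⊆ w.1ᶜ from Finset.subset_compl_iff_disjoint_right.2 hd)
        (show v.1.card ≤ 4 by rw [v.2]; omega) (by rw [Finset.card_compl, w.2]; decide)
      obtain ⟨t, hwt, hts, ht⟩ := Finset.exists_subsuperset_card_eq
        (show w.1 ⊆ sᶜ from Finset.subset_compl_comm.1 hsw)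
        (show w.1.card ≤ 4 by rw [w.2]; omega) (by rw [Finset.card_compl, hs]; decide)
      obtain ⟨P, hP, h1, h2⟩ := exists_quad_partition_of_disjoint hs ht
        (Finset.subset_compl_iff_disjoint_left.1 hts)
      exact mk P hP ⟨s, h1, hvs⟩ ⟨t, h2, hwt⟩
    · obtain ⟨t, hts, ht⟩ := Finset.exists_subset_card_eq
        (show 4 ≤ (v.1 ∪ w.1)ᶜ.card by rw [Finset.card_compl, Fintype.card_fin]; omega)
      obtain ⟨P, hP, h1, -⟩ := exists_quad_partition_of_disjoint (show (v.1 ∪ w.1).card = 4 by omega)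
        ht (Finset.subset_compl_iff_disjoint_left.1 hts)
      exact mk P hP ⟨_, h1, Finset.subset_union_left⟩ ⟨_, h1, Finset.subset_union_right⟩
    · obtain ⟨P, hP, hv⟩ := exists_quad_partition v
      exact mk P hP hv (Triple.card_inter_eq_three h3 ▸ hv)

theorem scenarioJ12_adj_iff (v w : Triple) :
    scenarioJ12.nonOrthGraph.Adj v w ↔ (v.1 ∩ w.1).card = 1 := by
  rw [← not_iff_not, ← ne_eq, ← scenarioJ12_exists_edge_iff]
  exact not_not

theorem modelA_mem_probModels : modelA ∈ scenarioJ12.probModels := by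
  refine ⟨fun v => by norm_num [modelA], ?_⟩
  rintro e ⟨P, hP, he⟩
  have hparts : P.parts.card = 3 := by
    have h := P.sum_card_parts
    rw [Finset.sum_congr rfl hP, Finset.sum_const, Finset.card_univ, Fintype.card_fin] at h
    simp at h
    omega
  have hmap : e.map ⟨Subtype.val, Subtype.val_injective⟩ =
      P.parts.biUnion fun t => t.powersetCard 3 := by
    ext x
    simp only [Finset.mem_map, Function.Embedding.coeFn_mk, Finset.mem_biUnion,
      Finset.mem_powersetCard]
    constructor
    · rintro ⟨v, hv, rfl⟩
      obtain ⟨t, ht, hvt⟩ := (he v).1 hv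
      exact ⟨t, ht, hvt, v.2⟩
    · rintro ⟨t, ht, hxt, hx⟩
      exact ⟨⟨x, hx⟩, (he _).2 ⟨t, ht, hxt⟩, rfl⟩
  have hcard : e.card = 12 := by
    rw [← Finset.card_map, hmap, Finset.card_biUnion, Finset.sum_congr rfl fun t ht => by
      rw [Finset.card_powersetCard, hP t ht], Finset.sum_const, hparts]
    · rfl
    · intro s hs t ht hst
      refine Finset.disjoint_left.2 ?_
      intro x hxs hxt
      rw [Finset.mem_powersetCard] at hxs hxt
      obtain ⟨y, hy⟩ := Finset.card_pos.1 (show 0 < x.card by omega)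
      exact hst (P.eq_of_mem_parts hs ht (hxs.1 hy) (hxt.1 hy))
  simp [modelA, hcard]

/-- For incidence vectors the product is the size of the intersection mod 2: odd for equal triples,
and even (0 or 2) for distinct triples sharing an edge. -/
theorem scenarioJ12_hasBinaryRep : scenarioJ12.HasBinaryRep 12 := by
  have key : ∀ u v : Triple, (fun i : Fin 12 => if i ∈ u.1 then (1 : ZMod 2) else 0) ⬝ᵥ
      (fun i : Fin 12 => if i ∈ v.1 then (1 : ZMod 2) else 0) = ((u.1 ∩ v.1).card : ZMod 2) := by
    intro u v
    simp [dotProduct, ← ite_and, ← Finset.mem_inter, Finset.inter_comm]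
  refine ⟨Fin 12, inferInstance, fun v i => if i ∈ v.1 then 1 else 0, Fintype.card_fin 12,
    fun v => ?_, fun u v huv h => ?_⟩
  · rw [key, Finset.inter_self, v.2]
    rfl
  · have h1 := (scenarioJ12_exists_edge_iff u v).1 h
    have h2 := Triple.card_inter_le u v
    have h3 : (u.1 ∩ v.1).card ≠ 3 := fun h => huv (Triple.card_inter_eq_three h)
    rw [key]
    have : (u.1 ∩ v.1).card = 0 ∨ (u.1 ∩ v.1).card = 2 := by omega
    rcases this with h | h <;> rw [h] <;> rfl

theorem modelA_mem_consistentExclusivityInf : modelA ∈ scenarioJ12.consistentExclusivityInf := by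
  have h := scenarioJ12_hasBinaryRep.const_mem_consistentExclusivityInf (by norm_num)
    (by exact_mod_cast modelA_mem_probModels)
  exact_mod_cast h

/-! ### Symmetry reduction and kernel identities in the Johnson scheme -/

/-- Two pairs of finite sets with the same cardinalities are related by a permutation. -/
theorem exists_perm_image_pair {α : Type} [Fintype α] [DecidableEq α] {u v u' v' : Finset α}
    (hu : u.card = u'.card) (hv : v.card = v'.card) (huv : (u ∩ v).card = (u' ∩ v').card) :
    ∃ σ : Equiv.Perm α, (∀ x, σ x ∈ u' ↔ x ∈ u) ∧ ∀ x, σ x ∈ v' ↔ x ∈ v := by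
  let f : Finset α → Finset α → α → Bool × Bool := fun a b x => (decide (x ∈ a), decide (x ∈ b))
  -- The four cells of the Venn diagram have equal sizes for both pairs; bijections between the
  -- cells glue to the permutation.
  have hcard : ∀ c, Fintype.card {x // f u v x = c} = Fintype.card {x // f u' v' x = c} := by
    have aux : ∀ a b : Finset α, ∀ c, Fintype.card {x // f a b x = c} =
        match c with
        | (true, true) => (a ∩ b).card
        | (true, false) => a.card - (a ∩ b).card
        | (false, true) => b.card - (a ∩ b).card
        | (false, false) => Fintype.card α - (a.card + b.card - (a ∩ b).card) := by
      intro a b c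
      rw [Fintype.card_subtype]
      have h1 := Finset.card_union_add_card_inter a b
      rcases c with ⟨_ | _, _ | _⟩ <;> simp only
      · rw [show a.card + b.card - (a ∩ b).card = (a ∪ b).card by omega, ← Finset.card_compl]
        congr 1
        ext x
        simp [f]
      · rw [← Finset.card_sdiff_add_card_inter b a, Finset.inter_comm b a, Nat.add_sub_cancel]
        congr 1
        ext x
        simp [f, and_comm]
      · rw [← Finset.card_sdiff_add_card_inter a b, Nat.add_sub_cancel]
        congr 1
        ext x
        simp [f]
      · congr 1
        ext x
        simp [f]
    intro c
    rw [aux, aux, hu, hv, huv]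
  let σ := Equiv.ofFiberEquiv fun c => Fintype.equivOfCardEq (hcard c)
  have hσ : ∀ x, f u' v' (σ x) = f u v x := fun x => Equiv.ofFiberEquiv_map _ x
  refine ⟨σ, fun x => ?_, fun x => ?_⟩
  · simpa [f] using congrArg Prod.fst (hσ x)
  · simpa [f] using congrArg Prod.snd (hσ x)

/-- The triples with a given cardinality of the intersection with `{0, 1, 2}`. -/
def refTriple : Fin 4 → Triple :=
  ![⟨{3, 4, 5}, rfl⟩, ⟨{2, 3, 4}, rfl⟩, ⟨{1, 2, 3}, rfl⟩, ⟨{0, 1, 2}, rfl⟩]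

/-- Permutations act transitively on pairs of triples with given intersection size, so kernel
identities need checking only on four reference pairs, a finite computation. -/
theorem sum_card_inter_eq {M : Type} [AddCommMonoid M] (F : ℕ → ℕ → M) {u v u' v' : Triple}
    (h : (u.1 ∩ v.1).card = (u'.1 ∩ v'.1).card) :
    ∑ w : Triple, F (u.1 ∩ w.1).card (v.1 ∩ w.1).card =
      ∑ w : Triple, F (u'.1 ∩ w.1).card (v'.1 ∩ w.1).card := by
  obtain ⟨σ, h1, h2⟩ := exists_perm_image_pair (u.2.trans u'.2.symm) (v.2.trans v'.2.symm) h
  let τ : Triple ≃ Triple := σ.finsetCongr.subtypeEquiv fun s => by simp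
  refine Fintype.sum_equiv τ _ _ fun w => ?_
  have key : ∀ a b : Finset (Fin 12), (∀ x, σ x ∈ b ↔ x ∈ a) →
      (a ∩ w.1).card = (b ∩ (τ w).1).card := fun a b hab => by
    rw [← Finset.card_map σ.toEmbedding]
    congr 1
    ext x
    obtain ⟨x, rfl⟩ := σ.surjective x
    simp [τ, hab]
  rw [key _ _ h1, key _ _ h2]

theorem refTriple_card_inter (k : Fin 4) :
    ((refTriple k).1 ∩ (refTriple 3).1).card = k := by
  revert k
  decide

theorem exists_card_inter_refTriple (u v : Triple) :
    ∃ k : Fin 4, (u.1 ∩ v.1).card = k ∧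
      (u.1 ∩ v.1).card = ((refTriple k).1 ∩ (refTriple 3).1).card :=
  let k : Fin 4 := ⟨_, Nat.lt_succ_of_le (Triple.card_inter_le u v)⟩
  ⟨k, rfl, (refTriple_card_inter k).symm⟩

theorem tripleSphere_card (i : Fin 4) (v : Triple) :
    (tripleSphere i v).card = (![1, 27, 108, 84] : Fin 4 → ℕ) i := by
  rw [tripleSphere, Finset.card_filter,
    sum_card_inter_eq (fun a _ => if a + (i : ℕ) = 3 then 1 else 0) (v := v)
      (u' := refTriple 3) (v' := refTriple 3) (by simp [v.2, (refTriple 3).2])]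
  revert i
  decide +kernel

/-- The values of `22 √110 φ_v - √26` on the triples meeting `v` in `k` elements. -/
def labelKernel (k : ℕ) : ℤ := (![9, -13, 20, 108] : Fin 4 → ℤ) (Fin.ofNat 4 k)

/-- The entries of `90 (11 E₀ + 5 E₁ + 4 E₃)`, where `E_j` are the projections onto the eigenspaces
of the Johnson scheme; up to a factor this is a square root of `1 + A / 13`, for the adjacency matrix
`A` of `NO(J₁₂)`, whose eigenvalues are `108, 12, -13, 3`. -/
def dualKernel (k : ℕ) : ℤ := (![-6, 14, -11, 279] : Fin 4 → ℤ) (Fin.ofNat 4 k)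

theorem sum_labelKernel (v : Triple) : ∑ w : Triple, labelKernel (v.1 ∩ w.1).card = 0 := by
  rw [sum_card_inter_eq (fun a _ => labelKernel a) (v := v)
      (u' := refTriple 3) (v' := refTriple 3) (by simp [v.2, (refTriple 3).2])]
  decide +kernel

theorem sum_dualKernel (v : Triple) : ∑ w : Triple, dualKernel (v.1 ∩ w.1).card = 990 := by
  rw [sum_card_inter_eq (fun a _ => dualKernel a) (v := v)
      (u' := refTriple 3) (v' := refTriple 3) (by simp [v.2, (refTriple 3).2])]
  decide +kernel

/-- The table is 440 times that of `labelKernel`: the kernel is 440 times an orthogonal projection,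
of rank 220 · 108 / 440 = 54, onto the eigenspace of `A` for -13. -/
theorem sum_labelKernel_mul (u v : Triple) :
    ∑ w : Triple, labelKernel (u.1 ∩ w.1).card * labelKernel (v.1 ∩ w.1).card =
      (![3960, -5720, 8800, 47520] : Fin 4 → ℤ) (Fin.ofNat 4 (u.1 ∩ v.1).card) := by
  obtain ⟨k, hk, hk'⟩ := exists_card_inter_refTriple u v
  rw [sum_card_inter_eq (fun a b => labelKernel a * labelKernel b) hk', hk]
  clear hk hk'
  revert k
  decide +kernel

/-- The table is that of `8100 (13 + A)`. Its zeros at 0 and 2 are the orthogonality relations of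
the dual labeling. -/
theorem sum_dualKernel_mul (u v : Triple) :
    ∑ w : Triple, dualKernel (u.1 ∩ w.1).card * dualKernel (v.1 ∩ w.1).card =
      (![0, 8100, 0, 105300] : Fin 4 → ℤ) (Fin.ofNat 4 (u.1 ∩ v.1).card) := by
  obtain ⟨k, hk, hk'⟩ := exists_card_inter_refTriple u v
  rw [sum_card_inter_eq (fun a b => dualKernel a * dualKernel b) hk', hk]
  clear hk hk'
  revert k
  decide +kernel

/-! ### The explicit labelings of `NO(J₁₂)` and its complement -/

theorem card_triple : Fintype.card Triple = 220 := by
  simp [Fintype.card_finset_len, Nat.choose]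

theorem handleVector_apply (w : Triple) : handleVector w = 1 / √220 := by
  simp [handleVector]

theorem norm_handleVector : ‖handleVector‖ = 1 := by
  rw [EuclideanSpace.norm_eq, Real.sqrt_eq_one]
  simp only [handleVector_apply, norm_div, norm_one, Real.norm_eq_abs, abs_of_nonneg,
    Real.sqrt_nonneg, div_pow, one_pow, Finset.sum_const, Finset.card_univ, card_triple,
    nsmul_eq_mul]
  rw [Real.sq_sqrt (by norm_num)]
  norm_num

theorem labelVector_apply_eq (v w : Triple) :
    labelVector v w = ∑ i : Fin 4, if (v.1 ∩ w.1).card + (i : ℕ) = 3 then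
      labelCoeff i / √(((![1, 27, 108, 84] : Fin 4 → ℕ) i : ℕ) : ℝ) else 0 := by
  simp only [labelVector, tripleSphere_card]
  simp [tripleSphere]

theorem labelVector_apply (v w : Triple) :
    labelVector v w = (√26 + labelKernel (v.1 ∩ w.1).card) / (22 * √110) := by
  have hle := Triple.card_inter_le v w
  have h26 : √26 = √2 * √13 := by rw [← Real.sqrt_mul (by norm_num)]; norm_num
  have h110 : √110 = √2 * √55 := by rw [← Real.sqrt_mul (by norm_num)]; norm_num
  have h27 : √27 = 3 * √3 := by
    rw [show (27 : ℝ) = 3 ^ 2 * 3 by norm_num, Real.sqrt_mul (by norm_num), Real.sqrt_sq (by norm_num)]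
  have h108 : √108 = 6 * √3 := by
    rw [show (108 : ℝ) = 6 ^ 2 * 3 by norm_num, Real.sqrt_mul (by norm_num),
      Real.sqrt_sq (by norm_num)]
  have h84 : √84 = 2 * (√3 * √7) := by
    rw [show (84 : ℝ) = 2 ^ 2 * (3 * 7) by norm_num, Real.sqrt_mul (by norm_num),
      Real.sqrt_sq (by norm_num), Real.sqrt_mul (by norm_num)]
  have h21 : √21 = √3 * √7 := by rw [← Real.sqrt_mul (by norm_num)]; norm_num
  have h2 : √2 ≠ 0 := by positivity
  have h3 : √3 ≠ 0 := by positivity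
  have h7 : √7 ≠ 0 := by positivity
  have h55 : √55 ≠ 0 := by positivity
  have s3 : √3 ^ 2 = 3 := Real.sq_sqrt (by norm_num)
  rw [labelVector_apply_eq]
  generalize (v.1 ∩ w.1).card = k at hle ⊢
  interval_cases k
  · simp [Fin.sum_univ_four, labelCoeff, vecB, vecC, labelKernel, h84, h21, h110, h26]
    field_simp
    ring
  · have hk : labelKernel 1 = -13 := rfl
    rw [hk]
    simp [Fin.sum_univ_four, labelCoeff, vecB, vecC, h108, h21, h110, h26]
    field_simp
    ring
  · simp [Fin.sum_univ_four, labelCoeff, vecB, vecC, labelKernel, h27, h21, h110, h26]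
    field_simp
    ring
  · simp [labelCoeff, vecB, vecC, labelKernel, h21, h110, h26]
    field_simp
    -- Only on the diagonal do two factors `√3` multiply, from `6√3 / 11` and the first entry of
    -- `c`; in the other cases `√|Dᵢ|` cancels one.
    linear_combination 792 * s3

/-- The cross terms vanish because the rows of `labelKernel` sum to zero. The constants are 5720 =
220 · 26 and 53240 = (22√110)², so the product vanishes exactly where the kernel is -13. -/
theorem inner_labelVector (u v : Triple) : ⟪labelVector u, labelVector v⟫_ℝ =
    (5720 + (![3960, -5720, 8800, 47520] : Fin 4 → ℤ) (Fin.ofNat 4 (u.1 ∩ v.1).card)) / 53240 := by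
  have h26 : √26 ^ 2 = 26 := Real.sq_sqrt (by norm_num)
  have h110 : √110 ^ 2 = 110 := Real.sq_sqrt (by norm_num)
  have hu : ∑ w : Triple, (labelKernel (u.1 ∩ w.1).card : ℝ) = 0 := by
    exact_mod_cast sum_labelKernel u
  have hv : ∑ w : Triple, (labelKernel (v.1 ∩ w.1).card : ℝ) = 0 := by
    exact_mod_cast sum_labelKernel v
  have huv := congrArg (Int.cast (R := ℝ)) (sum_labelKernel_mul u v)
  push_cast at huv
  have key : ∀ w, ⟪labelVector u w, labelVector v w⟫_ℝ = (26 + √26 * labelKernel (u.1 ∩ w.1).card +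
      √26 * labelKernel (v.1 ∩ w.1).card +
      labelKernel (u.1 ∩ w.1).card * labelKernel (v.1 ∩ w.1).card) / 53240 := fun w => by
    rw [labelVector_apply, labelVector_apply, RCLike.inner_apply, conj_trivial, div_mul_div_comm,
      show 22 * √110 * (22 * √110) = 53240 by nlinarith]
    congr 1
    linear_combination h26
  rw [PiLp.inner_apply, Finset.sum_congr rfl fun w _ => key w, ← Finset.sum_div,
    Finset.sum_add_distrib, Finset.sum_add_distrib, Finset.sum_add_distrib, ← Finset.mul_sum,
    ← Finset.mul_sum, hu, hv, huv, Finset.sum_const, Finset.card_univ, card_triple]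
  norm_num

theorem isOrthonormalLabeling_labelVector :
    IsOrthonormalLabeling scenarioJ12.nonOrthGraphᶜ labelVector := by
  refine ⟨fun v => ?_, fun u v huv h => ?_⟩
  · have h := inner_labelVector v v
    rw [real_inner_self_eq_norm_sq, Finset.inter_self, v.2] at h
    refine (pow_eq_one_iff_of_nonneg (norm_nonneg _) two_ne_zero).1 (h.trans ?_)
    norm_num [Fin.ofNat]
  · have hadj : (u.1 ∩ v.1).card = 1 := by
      rw [← scenarioJ12_adj_iff]
      by_contra h'
      exact h ((SimpleGraph.compl_adj _ _ _).2 ⟨huv, h'⟩)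
    rw [inner_labelVector, hadj]
    norm_num [Fin.ofNat]

theorem inner_handleVector_labelVector_sq (v : Triple) :
    ⟪handleVector, labelVector v⟫_ℝ ^ 2 = 13 / 121 := by
  have hv : ∑ w : Triple, (labelKernel (v.1 ∩ w.1).card : ℝ) = 0 := by
    exact_mod_cast sum_labelKernel v
  have h : ⟪handleVector, labelVector v⟫_ℝ = 220 * √26 / (22 * √110 * √220) := by
    rw [PiLp.inner_apply]
    simp only [handleVector_apply, labelVector_apply, RCLike.inner_apply, conj_trivial]
    rw [← Finset.sum_mul, ← Finset.sum_div, Finset.sum_add_distrib, hv, Finset.sum_const,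
      Finset.card_univ, card_triple, div_mul_div_comm]
    norm_num
  rw [h, div_pow, mul_pow, mul_pow, mul_pow, Real.sq_sqrt (by norm_num), Real.sq_sqrt (by norm_num),
    Real.sq_sqrt (by norm_num)]
  norm_num

/-- The orthonormal labeling of `NO(J₁₂)` dual to `labelVector`. -/
noncomputable def dualLabelVector (v : Triple) : EuclideanSpace ℝ Triple :=
  WithLp.toLp 2 fun w => (dualKernel (v.1 ∩ w.1).card : ℝ) / (90 * √13)

theorem inner_dualLabelVector (u v : Triple) : ⟪dualLabelVector u, dualLabelVector v⟫_ℝ =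
    ((![0, 8100, 0, 105300] : Fin 4 → ℤ) (Fin.ofNat 4 (u.1 ∩ v.1).card)) / 105300 := by
  have h13 : √13 ^ 2 = 13 := Real.sq_sqrt (by norm_num)
  have huv := congrArg (Int.cast (R := ℝ)) (sum_dualKernel_mul u v)
  push_cast at huv
  rw [PiLp.inner_apply, ← huv, Finset.sum_div]
  refine Finset.sum_congr rfl fun w _ => ?_
  simp only [dualLabelVector, RCLike.inner_apply, conj_trivial]
  rw [div_mul_div_comm, show 90 * √13 * (90 * √13) = 105300 by nlinarith, mul_comm]

theorem isOrthonormalLabeling_dualLabelVector :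
    IsOrthonormalLabeling scenarioJ12.nonOrthGraph dualLabelVector := by
  refine ⟨fun v => ?_, fun u v huv h => ?_⟩
  · have h := inner_dualLabelVector v v
    rw [real_inner_self_eq_norm_sq, Finset.inter_self, v.2] at h
    refine (pow_eq_one_iff_of_nonneg (norm_nonneg _) two_ne_zero).1 (h.trans ?_)
    norm_num [Fin.ofNat]
  · rw [scenarioJ12_adj_iff] at h
    have hle := Triple.card_inter_le u v
    have h3 : (u.1 ∩ v.1).card ≠ 3 := fun h => huv (Triple.card_inter_eq_three h)
    have : (u.1 ∩ v.1).card = 0 ∨ (u.1 ∩ v.1).card = 2 := by omega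
    rw [inner_dualLabelVector]
    rcases this with h | h <;> rw [h] <;> norm_num [Fin.ofNat]

theorem inner_handleVector_dualLabelVector_sq (v : Triple) :
    ⟪handleVector, dualLabelVector v⟫_ℝ ^ 2 = 11 / 260 := by
  have hv : ∑ w : Triple, (dualKernel (v.1 ∩ w.1).card : ℝ) = 990 := by
    exact_mod_cast sum_dualKernel v
  have h : ⟪handleVector, dualLabelVector v⟫_ℝ = 990 / (90 * √13 * √220) := by
    rw [PiLp.inner_apply]
    simp only [handleVector_apply, dualLabelVector, RCLike.inner_apply, conj_trivial]
    rw [← Finset.sum_mul, ← Finset.sum_div, hv, div_mul_div_comm, mul_one]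
  rw [h, div_pow, mul_pow, mul_pow, Real.sq_sqrt (by norm_num), Real.sq_sqrt (by norm_num)]
  norm_num

/-! ### Duality for orthonormal labelings -/

section Lovasz

variable {V : Type} [Fintype V] {G : SimpleGraph V}

-- Distinct vertices are non-adjacent in `G` or in `Gᶜ`, so one tensor factor of `φ v ⊗ ψ v` is
-- always orthogonal. The bound is Bessel's inequality for `Ψ ⊗ Φ`.
open scoped TensorProduct in
theorem sum_inner_sq_mul_inner_sq_le_one {Ψ Φ : EuclideanSpace ℝ V}
    {φ ψ : V → EuclideanSpace ℝ V} (hΨ : ‖Ψ‖ = 1) (hΦ : ‖Φ‖ = 1)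
    (hφ : IsOrthonormalLabeling Gᶜ φ) (hψ : IsOrthonormalLabeling G ψ) :
    ∑ v, ⟪Ψ, φ v⟫_ℝ ^ 2 * ⟪Φ, ψ v⟫_ℝ ^ 2 ≤ 1 := by
  have hon : Orthonormal ℝ fun v => φ v ⊗ₜ[ℝ] ψ v := by
    refine ⟨fun v => by rw [TensorProduct.norm_tmul, hφ.1, hψ.1, mul_one], fun u v huv => ?_⟩
    change ⟪φ u ⊗ₜ[ℝ] ψ u, φ v ⊗ₜ[ℝ] ψ v⟫_ℝ = 0
    rw [TensorProduct.inner_tmul]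
    by_cases h : G.Adj u v
    · rw [hφ.2 u v huv fun h' => ((SimpleGraph.compl_adj _ _ _).1 h').2 h, zero_mul]
    · rw [hψ.2 u v huv h, mul_zero]
  have h := hon.sum_inner_products_le (Ψ ⊗ₜ[ℝ] Φ) (s := Finset.univ)
  rw [TensorProduct.norm_tmul, hΨ, hΦ, mul_one, one_pow] at h
  refine le_trans (le_of_eq (Finset.sum_congr rfl fun v _ => ?_)) h
  rw [TensorProduct.inner_tmul, Real.norm_eq_abs, sq_abs, mul_pow, real_inner_comm Ψ,
    real_inner_comm Φ]

/-- A uniform dual labeling bounds `∑ v, ⟨Ψ, φ_v⟩²` over the orthonormal labelings of `Gᶜ`. -/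
theorem sum_inner_sq_le {c : ℝ} (hc : 0 < c) {Φ : EuclideanSpace ℝ V}
    {ψ : V → EuclideanSpace ℝ V} (hΦ : ‖Φ‖ = 1) (hψ : IsOrthonormalLabeling G ψ)
    (h : ∀ v, ⟪Φ, ψ v⟫_ℝ ^ 2 = c⁻¹) {Ψ : EuclideanSpace ℝ V} {φ : V → EuclideanSpace ℝ V}
    (hΨ : ‖Ψ‖ = 1) (hφ : IsOrthonormalLabeling Gᶜ φ) : ∑ v, ⟪Ψ, φ v⟫_ℝ ^ 2 ≤ c := by
  have h1 := sum_inner_sq_mul_inner_sq_le_one hΨ hΦ hφ hψ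
  simp only [h] at h1
  rwa [← Finset.sum_mul, ← div_eq_mul_inv, div_le_one hc] at h1

/-- Uniform labelings of `G` and `Gᶜ` whose values match determine the Lovász number. -/
theorem lovaszNumber_eq [Nonempty V] {c d : ℝ} (hc : 0 < c) (hd : 0 < d)
    (hcd : Fintype.card V * d = c)
    {Φ Ψ : EuclideanSpace ℝ V} {ψ φ : V → EuclideanSpace ℝ V} (hΦ : ‖Φ‖ = 1)
    (hψ : IsOrthonormalLabeling G ψ) (h : ∀ v, ⟪Φ, ψ v⟫_ℝ ^ 2 = c⁻¹) (hΨ : ‖Ψ‖ = 1)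
    (hφ : IsOrthonormalLabeling Gᶜ φ) (h' : ∀ v, ⟪Ψ, φ v⟫_ℝ ^ 2 = d) :
    lovaszNumber G = ENNReal.ofReal c := by
  refine le_antisymm ?_ ?_
  · refine iInf_le_of_le Φ (iInf_le_of_le ψ (iInf_le_of_le hΦ (iInf_le_of_le hψ ?_)))
    refine iSup_le fun v => ?_
    rw [h, ENNReal.ofReal_inv_of_pos hc, inv_inv]
  · refine le_iInf fun Φ' => le_iInf fun ψ' => le_iInf fun hΦ' => le_iInf fun hψ' => ?_
    have h1 := sum_inner_sq_mul_inner_sq_le_one hΨ hΦ' hφ hψ'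
    simp only [h'] at h1
    -- By averaging, some vertex has `d ⟨Φ', ψ' v⟩² ≤ 1 / |V|`, that is `⟨Φ', ψ' v⟩² ≤ 1 / c`.
    obtain ⟨v, -, hv⟩ := Finset.exists_le_of_sum_le (s := (Finset.univ : Finset V))
      (f := fun v => d * ⟪Φ', ψ' v⟫_ℝ ^ 2) (g := fun _ => (Fintype.card V : ℝ)⁻¹)
      Finset.univ_nonempty (by
        rw [Finset.sum_const, Finset.card_univ, nsmul_eq_mul, mul_inv_cancel₀
          (Nat.cast_ne_zero.2 Fintype.card_ne_zero)]
        exact h1)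
    refine le_iSup_of_le v ?_
    rw [ENNReal.le_inv_iff_le_inv, ← ENNReal.ofReal_inv_of_pos hc]
    refine ENNReal.ofReal_le_ofReal ?_
    rw [← hcd, mul_inv, ← div_eq_mul_inv, le_div_iff₀ hd, mul_comm]
    exact hv

end Lovasz

/-! ### The quantum realization of `modelB` -/

theorem hasOperatorTrace_rankOne_mul {K : Type} [NormedAddCommGroup K] [InnerProductSpace ℂ K]
    [CompleteSpace K] (x y : K) (T : K →L[ℂ] K) :
    HasOperatorTrace (InnerProductSpace.rankOne ℂ x y * T) ⟪y, T x⟫_ℂ := by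
  intro ι b
  have h := b.hasSum_inner_mul_inner (T.adjoint y) x
  rw [ContinuousLinearMap.adjoint_inner_left] at h
  refine (congrArg (fun f => HasSum f _) (funext fun i => ?_)).mpr h
  rw [mul_apply_eq_comp, InnerProductSpace.rankOne_apply, inner_smul_right,
    ContinuousLinearMap.adjoint_inner_left]

/-- The complexification of a real vector. -/
noncomputable def EuclideanSpace.complexify {V : Type} (x : EuclideanSpace ℝ V) :
    EuclideanSpace ℂ V := WithLp.toLp 2 fun v => (x v : ℂ)

theorem EuclideanSpace.inner_complexify {V : Type} [Fintype V] (x y : EuclideanSpace ℝ V) :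
    ⟪x.complexify, y.complexify⟫_ℂ = (⟪x, y⟫_ℝ : ℂ) := by
  simp [PiLp.inner_apply, EuclideanSpace.complexify]

theorem EuclideanSpace.norm_complexify {V : Type} [Fintype V] {x : EuclideanSpace ℝ V}
    (hx : ‖x‖ = 1) : ‖x.complexify‖ = 1 := by
  have h := EuclideanSpace.inner_complexify x x
  rw [inner_self_eq_ofReal_norm_sq, Complex.ofReal_inj, real_inner_self_eq_norm_sq, hx,
    one_pow] at h
  exact (pow_eq_one_iff_of_nonneg (norm_nonneg _) two_ne_zero).1 h

/-- The projections onto `φ u` and `φ v` are orthogonal for adjacent `u`, `v`, so the no-detection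
vertex of the edge can carry the complementary projection `1 - Q u - Q v`. -/
theorem mem_quantumModels_noDetectionScenario {V : Type} [Fintype V] {G : SimpleGraph V}
    (hG : ∀ v, ∃ w, G.Adj v w) {Ψ : EuclideanSpace ℝ V} {φ : V → EuclideanSpace ℝ V} {c : ℝ}
    (hΨ : ‖Ψ‖ = 1) (hφ : IsOrthonormalLabeling Gᶜ φ) (h : ∀ v, ⟪Ψ, φ v⟫_ℝ ^ 2 = c) :
    (Sum.elim (fun _ => c) (fun _ => 1 - 2 * c) : V ⊕ G.edgeSet → ℝ) ∈
      (noDetectionScenario G hG).quantumModels := by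
  classical
  let Q : V → EuclideanSpace ℂ V →L[ℂ] EuclideanSpace ℂ V := fun v =>
    InnerProductSpace.rankOne ℂ (φ v).complexify (φ v).complexify
  let P : V ⊕ G.edgeSet → EuclideanSpace ℂ V →L[ℂ] EuclideanSpace ℂ V :=
    Sum.elim Q fun e => 1 - ∑ v with v ∈ e.1, Q v
  have hQ : ∀ v, IsStarProjection (Q v) := fun v =>
    InnerProductSpace.isStarProjection_rankOne_self (EuclideanSpace.norm_complexify (hφ.1 v))
  have hedge : ∀ e : G.edgeSet, ∃ u v, u ≠ v ∧ G.Adj u v ∧ (∀ x, x ∈ e.1 ↔ x = u ∨ x = v) ∧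
      P (Sum.inr e) = 1 - (Q u + Q v) := by
    rintro ⟨e, he⟩
    induction e using Sym2.ind with
    | _ u v =>
      have huv : G.Adj u v := he
      refine ⟨u, v, huv.ne, huv, fun x => Sym2.mem_iff, ?_⟩
      have : (Finset.univ.filter fun x => x ∈ s(u, v)) = {u, v} := by
        ext x
        simp
      simp only [P, Sum.elim_inr, this, Finset.sum_pair huv.ne]
  have hcomp : ∀ v, ⟪Ψ.complexify, Q v Ψ.complexify⟫_ℂ = (c : ℂ) := fun v => by
    rw [InnerProductSpace.rankOne_apply, inner_smul_right, EuclideanSpace.inner_complexify,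
      EuclideanSpace.inner_complexify, real_inner_comm, ← Complex.ofReal_mul, ← sq, h]
  have hself : ⟪Ψ.complexify, Ψ.complexify⟫_ℂ = 1 := by
    rw [EuclideanSpace.inner_complexify, real_inner_self_eq_norm_sq, hΨ, one_pow,
      Complex.ofReal_one]
  refine ⟨EuclideanSpace ℂ V, inferInstance, inferInstance, inferInstance,
    InnerProductSpace.rankOne ℂ Ψ.complexify Ψ.complexify, P,
    InnerProductSpace.isPositive_rankOne_self _, ?_, ?_, ?_, ?_⟩
  · have h1 := hasOperatorTrace_rankOne_mul Ψ.complexify Ψ.complexify 1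
    rwa [mul_one, one_apply_eq_self, hself] at h1
  · rintro (v | e)
    · exact hQ v
    · obtain ⟨u, v, huv, hadj, -, hP⟩ := hedge e
      rw [hP]
      refine ((hQ u).add (hQ v) ?_).one_sub
      ext1 x
      have h0 : ⟪(φ u).complexify, (φ v).complexify⟫_ℂ = 0 := by
        rw [EuclideanSpace.inner_complexify, hφ.2 u v huv fun h' =>
          ((SimpleGraph.compl_adj _ _ _).1 h').2 hadj, Complex.ofReal_zero]
      rw [mul_apply_eq_comp, InnerProductSpace.rankOne_apply,
        InnerProductSpace.rankOne_apply, inner_smul_right, h0, mul_zero, zero_smul]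
      rfl
  · rintro f ⟨e, hf⟩
    obtain ⟨u, v, huv, hadj, hmem, hP⟩ := hedge e
    have hfe : f = {Sum.inl u, Sum.inl v, Sum.inr e} := by
      ext x
      rw [hf]
      rcases x with x | x <;> simp [hmem]
    rw [hfe, Finset.sum_insert (by simp [huv]), Finset.sum_pair (by simp), hP]
    change Q u + (Q v + (1 - (Q u + Q v))) = 1
    abel
  · intro x
    have h1 := hasOperatorTrace_rankOne_mul Ψ.complexify Ψ.complexify (P x)
    rcases x with v | e
    · rw [show ⟪Ψ.complexify, P (Sum.inl v) Ψ.complexify⟫_ℂ = (c : ℂ) from hcomp v] at h1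
      exact h1
    · obtain ⟨u, v, -, -, -, hP⟩ := hedge e
      have h2 : ⟪Ψ.complexify, P (Sum.inr e) Ψ.complexify⟫_ℂ = ((1 - 2 * c : ℝ) : ℂ) := by
        rw [hP, sub_apply, add_apply, inner_sub_right, inner_add_right, hcomp, hcomp,
          one_apply_eq_self, hself]
        push_cast
        ring
      rw [h2] at h1
      exact h1

theorem modelB_mem_quantumModels : modelB ∈ activatingScenario.quantumModels := by
  have h := mem_quantumModels_noDetectionScenario scenarioJ12_no_isolated norm_handleVector
    isOrthonormalLabeling_labelVector inner_handleVector_labelVector_sq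
  have h1 : (1 : ℝ) - 2 * (13 / 121) = 95 / 121 := by norm_num
  rw [h1] at h
  exact h

/-! ### The diagonal violates Consistent Exclusivity -/

theorem activatingScenario_exists_edge {v w : Triple} (h : scenarioJ12.nonOrthGraph.Adj v w) :
    ∃ e ∈ activatingScenario.edges, Sum.inl v ∈ e ∧ Sum.inl w ∈ e := by
  classical
  refine ⟨{Sum.inl v, Sum.inl w, Sum.inr ⟨s(v, w), h⟩}, ⟨⟨s(v, w), h⟩, fun x => ?_⟩, by simp,
    by simp⟩
  rcases x with x | x <;> simp

theorem tensor_modelA_modelB_not_mem : ContextualityScenario.tensor modelA modelB ∉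
    (scenarioJ12.prod activatingScenario).consistentExclusivity := by
  rintro ⟨-, h⟩
  let d : Triple ↪ Triple × (Triple ⊕ scenarioJ12.nonOrthGraph.edgeSet) :=
    ⟨fun v => (v, Sum.inl v), fun v w hvw => congrArg Prod.fst hvw⟩
  have h1 := h (Finset.univ.map d) (by
    intro x hx y hy hxy
    simp only [Finset.coe_map, Finset.coe_univ, Set.image_univ, Set.mem_range] at hx hy
    obtain ⟨v, rfl⟩ := hx
    obtain ⟨w, rfl⟩ := hy
    have hvw : v ≠ w := fun h => hxy (congrArg d h)
    refine not_not.2 ?_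
    -- Adjacent triples share an edge of `H_B`, non-adjacent ones an edge of `J₁₂`; either makes the
    -- diagonal vertices share an edge of the product.
    by_cases hadj : scenarioJ12.nonOrthGraph.Adj v w
    · exact ContextualityScenario.exists_edge_prod_of_snd v w
        (fun h => hvw (Sum.inl_injective h)) (activatingScenario_exists_edge hadj)
    · exact ContextualityScenario.exists_edge_prod_of_fst _ _ hvw (not_not.1 hadj))
  rw [Finset.sum_map] at h1
  have h2 : ∀ v, ContextualityScenario.tensor modelA modelB (d v) = 1 / 12 * (13 / 121) :=
    fun v => rfl
  rw [Finset.sum_congr rfl fun v _ => h2 v, Finset.sum_const, Finset.card_univ, card_triple] at h1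
  norm_num at h1

theorem mainTheorem6 :
    -- violations of Consistent Exclusivity can be activated, even by a quantum model
    (∃ (V W : Type) (HA : ContextualityScenario V) (HB : ContextualityScenario W),
      ∃ pA ∈ HA.consistentExclusivityInf, ∃ pB ∈ HB.quantumModels,
        HB.quantumModels ⊆ HB.consistentExclusivityInf ∧
        ContextualityScenario.tensor pA pB ∈ (HA.prod HB).probModels ∧
        ContextualityScenario.tensor pA pB ∉ (HA.prod HB).consistentExclusivity) ∧
    -- the non-orthogonality graph of `J₁₂`
    (∀ v w : Triple, scenarioJ12.nonOrthGraph.Adj v w ↔ (v.1 ∩ w.1).card = 1) ∧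
    -- the explicit labeling, which attains the Lovász number `260/11`
    IsOrthonormalLabeling scenarioJ12.nonOrthGraphᶜ labelVector ∧
    ‖handleVector‖ = 1 ∧
    (∀ v, ⟪handleVector, labelVector v⟫_ℝ ^ 2 = 13 / 121) ∧
    ∑ v, ⟪handleVector, labelVector v⟫_ℝ ^ 2 = 260 / 11 ∧
    lovaszNumber scenarioJ12.nonOrthGraph = ENNReal.ofReal (260 / 11) ∧
    (∀ (Ψ : EuclideanSpace ℝ Triple) (φ : Triple → EuclideanSpace ℝ Triple), ‖Ψ‖ = 1 →
      IsOrthonormalLabeling scenarioJ12.nonOrthGraphᶜ φ → ∑ v, ⟪Ψ, φ v⟫_ℝ ^ 2 ≤ 260 / 11) ∧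
    -- the explicit instance of activation
    modelA ∈ scenarioJ12.consistentExclusivityInf ∧
    modelB ∈ activatingScenario.quantumModels ∧
    activatingScenario.quantumModels ⊆ activatingScenario.consistentExclusivityInf ∧
    ContextualityScenario.tensor modelA modelB ∈ (scenarioJ12.prod activatingScenario).probModels ∧
    ContextualityScenario.tensor modelA modelB ∉
      (scenarioJ12.prod activatingScenario).consistentExclusivity := by
  have hA := modelA_mem_consistentExclusivityInf
  have hB := modelB_mem_quantumModels
  have hQ := ContextualityScenario.quantumModels_subset_consistentExclusivityInf
    (H := activatingScenario)
  have hT := ContextualityScenario.tensor_mem_probModels modelA_mem_probModels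
    (ContextualityScenario.quantumModels_subset_probModels hB)
  have hN := tensor_modelA_modelB_not_mem
  have hdual : ∀ v, ⟪handleVector, dualLabelVector v⟫_ℝ ^ 2 = (260 / 11 : ℝ)⁻¹ := fun v => by
    rw [inner_handleVector_dualLabelVector_sq]
    norm_num
  refine ⟨⟨_, _, scenarioJ12, activatingScenario, modelA, hA, modelB, hB, hQ, hT, hN⟩,
    scenarioJ12_adj_iff, isOrthonormalLabeling_labelVector, norm_handleVector,
    inner_handleVector_labelVector_sq, ?_, ?_, fun Ψ φ hΨ hφ => ?_, hA, hB, hQ, hT, hN⟩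
  · simp only [inner_handleVector_labelVector_sq]
    rw [Finset.sum_const, Finset.card_univ, card_triple]
    norm_num
  · have : Nonempty Triple := ⟨refTriple 0⟩
    exact lovaszNumber_eq (by norm_num) (by norm_num : (0 : ℝ) < 13 / 121)
      (by rw [card_triple]; norm_num) norm_handleVector isOrthonormalLabeling_dualLabelVector hdual
      norm_handleVector isOrthonormalLabeling_labelVector inner_handleVector_labelVector_sq
  · exact sum_inner_sq_le (by norm_num) norm_handleVector isOrthonormalLabeling_dualLabelVector
      hdual hΨ hφ
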